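/- Theorem 3.1. Let $X$ and $U$ be (real or complex) Hilbert spaces, and let $A:D(A)\subset X\to X$ generate an analytic semigroup $\{S(t)\}_{t\ge 0}$ on $X$ (for real $X$: its complexification is analytic). Let $X_{-1}\supset X$ be the dual of $D(A^*)$ (with the graph norm) with respect to the pivot space $X$, and denote the extension of $S(t)$ to $X_{-1}$ by $S(t)$ again. Let $B\in\mathcal L(U,X_{-1})$ be an admissible control operator, i.e. there is a $\tau>0$ such that $\int_0^\tau S(\tau-t)Bf(t)\,dt\in X$ for all $f\in L^2(0,\tau;U)$, and let $B^*\in\mathcal L(D(A^*),U)$ be its adjoint. Assume that there are constants $d,k>0$ such that $$\|S(L)^*\varphi\|_X^2\le e^{d/L^k}\int_0^L\|B^*S(t)^*\varphi\|_U^2\,dt\qquad\text{for all }\varphi\in D(A^*),\ L\in(0,1].$$ Let $z_0,z_1\in X$ with $z_1\ne z_0$ and let $M>0$. For measurable $f:(0,\infty)\to U$ with $f\in L^2_{loc}([0,\infty);U)$ let $$z(t;f)=S(t)z_0+\int_0^tS(t-s)Bf(s)\,ds,\qquad t\ge 0,$$ be the solution of $z'=Az+Bf$, $z(0)=z_0$.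 Let $\mathcal U_M$ be the set of measurable $f:(0,\infty)\to U$ with $\|f(t)\|_U\le M$ for a.e. $t>0$, and let $$T(M)=\inf\{t>0:\ z(t;f)=z_1\text{ for some }f\in\mathcal U_M\}.$$ Then the time optimal control problem has the bang-bang property: if this set of times is non-empty, every optimal control, i.e. every $f^*\in\mathcal U_M$ with $z(T(M);f^*)=z_1$, satisfies $\|f^*(t)\|_U=M$ for a.e. $t\in(0,T(M))$. -/

import Mathlib

open Filter Topology MeasureTheory
open scoped NNReal

noncomputable section

universe u v

/-- A strongly continuous (`C₀`) semigroup of bounded linear operators on `X`. -/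
structure C0Semigroup (𝕜 : Type*) [RCLike 𝕜] (X : Type u) [NormedAddCommGroup X]
    [InnerProductSpace 𝕜 X] where
  /-- the operators `S(t)`, `t ≥ 0` -/
  op : ℝ≥0 → X →L[𝕜] X
  op_zero : op 0 = ContinuousLinearMap.id 𝕜 X
  op_add : ∀ s t : ℝ≥0, op (s + t) = (op s).comp (op t)
  continuous_orbit : ∀ x : X, Continuous fun t : ℝ≥0 => op t x

/-- The open sector `{z ≠ 0 : |arg z| < θ}` of the complex plane (for `0 < θ ≤ π`). -/
def openSector (θ : ℝ) : Set ℂ := {z | z ≠ 0 ∧ |z.arg| < θ}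

/-- `T` is an analytic semigroup in the sector `|arg z| < θ` on the complex Banach space `Y`:
it is holomorphic there for the operator norm, satisfies the semigroup law, and
`T z y → y` as `z → 0` inside the sector. -/
structure IsSectorialSemigroup {Y : Type*} [NormedAddCommGroup Y] [NormedSpace ℂ Y]
    (θ : ℝ) (T : ℂ → Y →L[ℂ] Y) : Prop where
  holomorphic : DifferentiableOn ℂ T (openSector θ)
  zero : T 0 = ContinuousLinearMap.id ℂ Y
  add : ∀ z ∈ openSector θ, ∀ w ∈ openSector θ, T (z + w) = (T z).comp (T w)
  tendsto : ∀ y : Y, Tendsto (fun z => T z y) (𝓝[openSector θ] 0) (𝓝 y)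

namespace C0Semigroup

variable {𝕜 : Type*} [RCLike 𝕜] {X : Type u} [NormedAddCommGroup X] [InnerProductSpace 𝕜 X]
  (S : C0Semigroup 𝕜 X)

/-- `S` is an analytic semigroup: it extends to an analytic semigroup `T` in a sector around
the positive half-line, on a complex Banach space `Y = X + iX`. For complex `X` one takes
`Y = X` (and `ι` the identity), for real `X` the complexification `Y = X ⊕ iX`. The isometric
real-linear map `ι : X → Y` is the inclusion. -/
def IsAnalytic : Prop :=
  ∃ (Y : Type u) (_ : NormedAddCommGroup Y) (_ : NormedSpace ℂ Y) (_ : CompleteSpace Y)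
    (ι : X →+ Y) (θ : ℝ) (T : ℂ → Y →L[ℂ] Y),
    (∀ x, ‖ι x‖ = ‖x‖) ∧
    (∀ (r : ℝ) (x : X), ι ((r : 𝕜) • x) = (r : ℂ) • ι x) ∧
    (∀ y, ∃ x₁ x₂, y = ι x₁ + Complex.I • ι x₂) ∧
    0 < θ ∧ θ ≤ Real.pi / 2 ∧ IsSectorialSemigroup θ T ∧
    ∀ (t : ℝ≥0) (x : X), T ((t : ℝ) : ℂ) (ι x) = ι (S.op t x)

/-- `y = lim_{h ↓ 0} (S(h) x - x) / h`. -/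
def HasGeneratorValue (x y : X) : Prop :=
  Tendsto (fun h : ℝ≥0 => (((h : ℝ) : 𝕜))⁻¹ • (S.op h x - x)) (𝓝[>] 0) (𝓝 y)

/-- The infinitesimal generator `A` of the semigroup, with
`D(A) = {x : lim_{h ↓ 0} (S(h) x - x) / h exists}`. -/
def generator : X →ₗ.[𝕜] X where
  domain :=
    { carrier := {x | ∃ y, S.HasGeneratorValue x y}
      zero_mem' := ⟨0, by simp [HasGeneratorValue]⟩
      add_mem' := by
        rintro a b ⟨y, hy⟩ ⟨w, hw⟩
        refine ⟨y + w, (hy.add hw).congr fun h => ?_⟩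
        rw [← smul_add, map_add]
        congr 1
        abel
      smul_mem' := by
        rintro c a ⟨y, hy⟩
        refine ⟨c • y, (hy.const_smul c).congr fun h => ?_⟩
        rw [map_smul, ← smul_sub, smul_comm] }
  toFun :=
    { toFun := fun x => Classical.choose x.2
      map_add' := fun a b => by
        refine tendsto_nhds_unique (Classical.choose_spec (a + b).2) ?_
        refine ((Classical.choose_spec a.2).add (Classical.choose_spec b.2)).congr fun h => ?_
        rw [← smul_add, Submodule.coe_add, map_add]
        congr 1
        abel
      map_smul' := fun c a => by
        refine tendsto_nhds_unique (Classical.choose_spec (c • a).2) ?_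
        refine ((Classical.choose_spec a.2).const_smul c).congr fun h => ?_
        rw [Submodule.coe_smul, map_smul, ← smul_sub, smul_comm] }

theorem generator_spec (x : S.generator.domain) :
    S.HasGeneratorValue (x : X) (S.generator x) :=
  Classical.choose_spec x.2

theorem generator_eq {x y : X} (h : S.HasGeneratorValue x y) :
    ∃ hx : x ∈ S.generator.domain, S.generator ⟨x, hx⟩ = y :=
  ⟨⟨y, h⟩, tendsto_nhds_unique (S.generator_spec ⟨x, ⟨y, h⟩⟩) h⟩

/-- `S(t)` maps `D(A)` into itself and commutes with `A` there. -/
theorem generator_op (t : ℝ≥0) (x : S.generator.domain) :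
    ∃ hx : S.op t x ∈ S.generator.domain,
      S.generator ⟨S.op t x, hx⟩ = S.op t (S.generator x) := by
  apply S.generator_eq
  refine (((S.op t).continuous.tendsto _).comp (S.generator_spec x)).congr fun h => ?_
  have h1 : S.op h (S.op t x) = S.op t (S.op h x) := by
    rw [← ContinuousLinearMap.comp_apply, ← S.op_add, add_comm, S.op_add,
      ContinuousLinearMap.comp_apply]
  simp only [Function.comp_apply, map_smul, map_sub, h1]

variable [CompleteSpace X]

theorem dense_generator_domain : Dense (S.generator.domain : Set X) := by
  let _ : NormedSpace ℝ X := NormedSpace.restrictScalars ℝ 𝕜 X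
  have : IsScalarTower ℝ 𝕜 X := ⟨fun r c x => by
    change (r • c) • x = ((algebraMap ℝ 𝕜 r) : 𝕜) • (c • x)
    rw [Algebra.smul_def, mul_smul]⟩
  have hsm : ∀ (r : ℝ) (x : X), ((r : 𝕜)) • x = r • x := fun r x => rfl
  intro x
  set g : ℝ → X := fun s => S.op s.toNNReal x with hg
  have hgc : Continuous g := (S.continuous_orbit x).comp continuous_real_toNNReal
  have hgi : ∀ a b : ℝ, IntervalIntegrable g volume a b := fun a b => hgc.intervalIntegrable a b
  have hg0 : g 0 = x := by simp [hg, S.op_zero]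
  set G : ℝ → X := fun r => ∫ s in (0 : ℝ)..r, g s with hG
  have hG0 : G 0 = 0 := by simp [hG]
  have hGd : ∀ r, HasDerivAt G (g r) r := fun r =>
    intervalIntegral.integral_hasDerivAt_right (hgi 0 r)
      (hgc.stronglyMeasurableAtFilter _ _) hgc.continuousAt
  have hto : Tendsto (fun h : ℝ≥0 => (h : ℝ)) (𝓝[>] 0) (𝓝[≠] 0) := by
    refine tendsto_nhdsWithin_iff.2 ⟨?_, ?_⟩
    · exact (NNReal.continuous_coe.tendsto' 0 0 NNReal.coe_zero).mono_left nhdsWithin_le_nhds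
    · filter_upwards [self_mem_nhdsWithin] with h hh
      simpa using (ne_of_gt hh)
  have hslope : ∀ r, Tendsto (fun h : ℝ≥0 => (h : ℝ)⁻¹ • (G (r + h) - G r)) (𝓝[>] 0) (𝓝 (g r)) :=
    fun r => ((hasDerivAt_iff_tendsto_slope_zero.1 (hGd r)).comp hto)
  have hmem : ∀ r : ℝ, 0 ≤ r → G r ∈ S.generator.domain := by
    intro r hr
    refine ⟨g r - g 0, ?_⟩
    refine ((hslope r).sub (hslope 0)).congr fun h => ?_
    have h1 : S.op h (G r) = G (r + h) - G h := by
      have e1 : S.op h (G r) = ∫ s in (0 : ℝ)..r, S.op h (g s) :=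
        (((S.op h).restrictScalars ℝ).intervalIntegral_comp_comm (hgi 0 r)).symm
      have e2 : (∫ s in (0 : ℝ)..r, S.op h (g s)) = ∫ s in (0 : ℝ)..r, g (s + h) := by
        refine intervalIntegral.integral_congr fun s hs => ?_
        rw [Set.uIcc_of_le hr] at hs
        simp only [hg]
        rw [Real.toNNReal_add (r := s) (p := (h : ℝ)) hs.1 h.2, Real.toNNReal_coe, add_comm, S.op_add]
        rfl
      rw [e1, e2, intervalIntegral.integral_comp_add_right, zero_add]
      exact (intervalIntegral.integral_interval_sub_left (hgi _ _) (hgi _ _)).symm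
    rw [h1, ← RCLike.ofReal_inv, hsm]
    rw [← smul_sub, hG0, zero_add]
    congr 1
    abel
  have hlim : Tendsto (fun h : ℝ≥0 => (h : ℝ)⁻¹ • (G h)) (𝓝[>] 0) (𝓝 x) := by
    have := hslope 0
    simpa only [zero_add, hG0, sub_zero, hg0] using this
  refine mem_closure_of_tendsto hlim (Eventually.of_forall fun h => ?_)
  rw [← hsm]
  exact S.generator.domain.smul_mem _ (hmem h h.2)

/-- `D(A*)` with the graph norm `(‖φ‖² + ‖A*φ‖²)^(1/2)`, realized as the graph of the adjoint
`A*` of the generator: its elements are the pairs `(φ, A*φ)`. -/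
def adjointDomain : Submodule 𝕜 (WithLp 2 (X × X)) :=
  (LinearPMap.adjoint S.generator).graph.comap (WithLp.linearEquiv 2 𝕜 (X × X)).toLinearMap

theorem mem_adjointDomain_iff (p : WithLp 2 (X × X)) :
    p ∈ S.adjointDomain ↔
      ∀ x : S.generator.domain, inner 𝕜 p.fst (S.generator x) = inner 𝕜 p.snd (x : X) := by
  have key : p ∈ S.adjointDomain ↔ p.ofLp ∈ S.generator.graph.adjoint := by
    rw [← LinearPMap.adjoint_graph_eq_graph_adjoint S.dense_generator_domain]
    rfl
  rw [key, Submodule.mem_adjoint_iff]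
  constructor
  · intro h x
    have := h x (S.generator x) (S.generator.mem_graph x)
    rw [sub_eq_zero] at this
    have h2 := congrArg (starRingEnd 𝕜) this
    simp only [inner_conj_symm] at h2
    exact h2
  · intro h a b hab
    obtain ⟨y, hy, rfl⟩ := (LinearPMap.mem_graph_iff _).1 hab
    have h2 := congrArg (starRingEnd 𝕜) (h y)
    simp only [inner_conj_symm] at h2
    rw [sub_eq_zero]
    have hy' : (y : X) = a := hy
    rw [← hy']
    exact h2

/-- The restriction of the adjoint operator `S(t)*` to `D(A*)`, which it leaves invariant,
as a bounded operator for the graph norm: `(φ, A*φ) ↦ (S(t)*φ, S(t)*A*φ)`. -/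
def adjointOp (t : ℝ≥0) : S.adjointDomain →L[𝕜] S.adjointDomain :=
  ((((WithLp.prodContinuousLinearEquiv 2 𝕜 X X).symm : X × X →L[𝕜] WithLp 2 (X × X)).comp
    (((S.op t).adjoint.prodMap (S.op t).adjoint).comp
      ((WithLp.prodContinuousLinearEquiv 2 𝕜 X X) : WithLp 2 (X × X) →L[𝕜] X × X))).comp
        S.adjointDomain.subtypeL).codRestrict S.adjointDomain fun p => by
    rw [mem_adjointDomain_iff]
    intro x
    obtain ⟨hx, hAx⟩ := S.generator_op t x
    have := (S.mem_adjointDomain_iff p).1 p.2 ⟨S.op t x, hx⟩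
    rw [hAx] at this
    change inner 𝕜 ((S.op t).adjoint (p : WithLp 2 (X × X)).fst) (S.generator x) =
      inner 𝕜 ((S.op t).adjoint (p : WithLp 2 (X × X)).snd) (x : X)
    rw [ContinuousLinearMap.adjoint_inner_left, ContinuousLinearMap.adjoint_inner_left]
    exact this

/-- `X₋₁`: the (anti-)dual of `D(A*)` with respect to the pivot space `X`. -/
abbrev Xneg : Type _ := S.adjointDomain →L⋆[𝕜] 𝕜

/-- The embedding `X → X₋₁`, `x ↦ (φ ↦ ⟨x, φ⟩)` (Mathlib's inner product is conjugate linear in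
its first argument). -/
def embed (x : X) : S.Xneg :=
  ((innerSL 𝕜 : X →L⋆[𝕜] X →L[𝕜] 𝕜).flip x).comp
    ((WithLp.fstL 2 𝕜 X X).comp S.adjointDomain.subtypeL)

/-- The extension of `S(t)` to `X₋₁`: `⟨S(t)ξ, φ⟩ = ⟨ξ, S(t)*φ⟩` for `φ ∈ D(A*)`. -/
def opNeg (t : ℝ≥0) (ξ : S.Xneg) : S.Xneg := ξ.comp (S.adjointOp t)

variable {U : Type v} [NormedAddCommGroup U] [InnerProductSpace 𝕜 U]

/-- The input map `Ψ_τ f = ∫₀^τ S(τ - t) B f(t) dt`, a Bochner integral in `X₋₁`. -/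
def inputMap (B : U →L[𝕜] S.Xneg) (τ : ℝ≥0) (f : ℝ → U) : S.Xneg :=
  ∫ t in (0 : ℝ)..τ, S.opNeg ((τ : ℝ) - t).toNNReal (B (f t))

/-- `B` is an admissible control operator: for some `τ > 0`, `Ψ_τ f ∈ X` for all
`f ∈ L²(0, τ; U)`. -/
def IsAdmissibleControl (B : U →L[𝕜] S.Xneg) : Prop :=
  ∃ τ : ℝ≥0, 0 < τ ∧ ∀ f : ℝ → U, MemLp f 2 (volume.restrict (Set.Ioo (0 : ℝ) τ)) →
    S.inputMap B τ f ∈ Set.range S.embed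

/-- The state `z(t; f, 0, z₀) = S(t) z₀ + ∫₀^t S(t - s) B f(s) ds` of `z' = A z + B f`,
`z(0) = z₀`, at time `t`, as an element of `X₋₁ ⊇ X`. -/
def state (B : U →L[𝕜] S.Xneg) (z₀ : X) (f : ℝ → U) (t : ℝ≥0) : S.Xneg :=
  S.embed (S.op t z₀) + S.inputMap B t f

/-- The admissible controls: measurable `f : (0, ∞) → U` with `‖f(t)‖ ≤ M` for a.e. `t > 0`. -/
def controls (U : Type v) [NormedAddCommGroup U] (M : ℝ) : Set (ℝ → U) :=
  {f | AEStronglyMeasurable f (volume.restrict (Set.Ioi (0 : ℝ))) ∧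
    ∀ᵐ t ∂(volume.restrict (Set.Ioi (0 : ℝ))), ‖f t‖ ≤ M}

/-- The times `t > 0` at which the target `z₁` can be reached from `z₀` with norm bound `M`. -/
def reachTimes (B : U →L[𝕜] S.Xneg) (z₀ z₁ : X) (M : ℝ) : Set ℝ≥0 :=
  {t | 0 < t ∧ ∃ f ∈ controls U M, S.state B z₀ f t = S.embed z₁}

/-- `f` is an optimal control and `T = T(M)` the optimal time: `T` is the infimum of the times
at which `z₁` can be reached (so there are such times), and `f` is a control with
`z(T; f, 0, z₀) = z₁`. -/
def IsOptimal (B : U →L[𝕜] S.Xneg) (z₀ z₁ : X) (M : ℝ) (T : ℝ≥0) (f : ℝ → U) : Prop :=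
  IsGLB (S.reachTimes B z₀ z₁ M) T ∧ f ∈ controls U M ∧ S.state B z₀ f T = S.embed z₁

/-- The bang-bang property of the time optimal control problem: every optimal control `f`
satisfies `‖f(t)‖ = M` for a.e. `t ∈ (0, T(M))`. -/
def BangBang (B : U →L[𝕜] S.Xneg) (z₀ z₁ : X) (M : ℝ) : Prop :=
  ∀ (T : ℝ≥0) (f : ℝ → U), S.IsOptimal B z₀ z₁ M T f →
    ∀ᵐ t ∂(volume.restrict (Set.Ioo (0 : ℝ) T)), ‖f t‖ = M

variable [CompleteSpace U]

/-- The adjoint `B* : D(A*) → U` of `B : U → X₋₁`: `⟨u, B*φ⟩_U = ⟨B u, φ⟩` for `u ∈ U`,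
`φ ∈ D(A*)`. -/
def adjointControl (B : U →L[𝕜] S.Xneg) (φ : S.adjointDomain) : U :=
  (InnerProductSpace.toDual 𝕜 U).symm (B.flip φ)

theorem inner_adjointControl (B : U →L[𝕜] S.Xneg) (φ : S.adjointDomain) (u : U) :
    inner 𝕜 (S.adjointControl B φ) u = B u φ := by
  simp [adjointControl]

/-- The observability inequality from time intervals for `(A*, B*)`:
`‖S(L)*φ‖² ≤ exp(d / L^k) ∫₀^L ‖B* S(t)* φ‖² dt` for all `φ ∈ D(A*)` and `L ∈ (0, 1]`. -/
def IsObservable (B : U →L[𝕜] S.Xneg) (d k : ℝ) : Prop :=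
  ∀ φ : S.adjointDomain, ∀ L : ℝ≥0, 0 < L → L ≤ 1 →
    ‖(S.op L).adjoint (φ : WithLp 2 (X × X)).fst‖ ^ 2 ≤
      Real.exp (d / (L : ℝ) ^ k) *
        ∫ t in (0 : ℝ)..L, ‖S.adjointControl B (S.adjointOp t.toNNReal φ)‖ ^ 2

end C0Semigroup

end

/-!
For an analytic semigroup the outputs `⟨B* S(t)* φ, u⟩` extend holomorphically to discs around
`s > 0` of radius proportional to `s`. Hence their size on a short interval is controlled by their
size on a subset of substantial measure, up to a factor `Λⁿ` and an error of order `Λ⁻²ⁿ`, with `n`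
free. Near a Lebesgue density point of a set `E` of times with positive measure, this turns
observability from intervals, at the cost `exp (d / L ^ k)`, into an interpolation inequality, and
telescoping over a geometric sequence of times gives
`‖S(T)* φ‖ ≤ C ∫_E ‖B* S(t)* φ‖ dt`. By Hahn-Banach duality small states are steered to zero by
small bounded controls supported in `E`.

Suppose now that an optimal control `f` satisfies `‖f‖ ≤ M - ε` on a set of positive measure. For
small `δ > 0` the state `z(δ; f)` is close to `z₀`. Starting at `z₀` with `f` shifted by `δ`, the
discrepancy `z(δ; f) - z₀` is corrected within the slack `ε`, and `z₁` is reached at the time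
`T(M) - δ`.
-/

theorem exists_dual_of_norm_le {𝕜 V N : Type*} [RCLike 𝕜] [AddCommGroup V] [Module 𝕜 V]
    [SeminormedAddCommGroup N] [NormedSpace 𝕜 N] (Φ : V →ₗ[𝕜] N) (l : V →ₗ[𝕜] 𝕜) {C : ℝ}
    (hC : 0 ≤ C) (h : ∀ v, ‖l v‖ ≤ C * ‖Φ v‖) :
    ∃ g : N →L[𝕜] 𝕜, ‖g‖ ≤ C ∧ ∀ v, g (Φ v) = l v := by
  have hker : l ∈ (LinearMap.ker Φ).dualAnnihilator := by
    refine (Submodule.mem_dualAnnihilator l).2 fun v hv => norm_le_zero_iff.1 ((h v).trans_eq ?_)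
    rw [LinearMap.mem_ker.1 hv, norm_zero, mul_zero]
  rw [← LinearMap.range_dualMap_eq_dualAnnihilator_ker] at hker
  obtain ⟨m, hm⟩ := hker
  have hml : ∀ v, m (Φ v) = l v := fun v => LinearMap.congr_fun hm v
  have hbound : ∀ y : LinearMap.range Φ, ‖(m.domRestrict (LinearMap.range Φ)) y‖ ≤ C * ‖y‖ := by
    rintro ⟨_, v, rfl⟩
    exact (congrArg norm (hml v)).trans_le (h v)
  obtain ⟨g, hg, hgn⟩ := exists_extension_norm_eq (LinearMap.range Φ)
    (LinearMap.mkContinuous _ C hbound)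
  exact ⟨g, hgn.trans_le (LinearMap.mkContinuous_norm_le _ hC _),
    fun v => (hg ⟨Φ v, v, rfl⟩).trans (hml v)⟩

theorem exists_inner_eq_of_norm_le {𝕜 V H : Type*} [RCLike 𝕜] [AddCommGroup V] [Module 𝕜 V]
    [NormedAddCommGroup H] [InnerProductSpace 𝕜 H] [CompleteSpace H] (Φ : V →ₗ[𝕜] H)
    (ξ : V →ₗ⋆[𝕜] 𝕜) {C : ℝ} (hC : 0 ≤ C) (h : ∀ v, ‖ξ v‖ ≤ C * ‖Φ v‖) :
    ∃ x : H, ‖x‖ ≤ C ∧ ∀ v, inner 𝕜 (Φ v) x = ξ v := by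
  let l : V →ₗ[𝕜] 𝕜 :=
    { toFun := fun v => starRingEnd 𝕜 (ξ v)
      map_add' := fun v w => by rw [map_add, map_add]
      map_smul' := fun c v => by simp }
  obtain ⟨g, hg, hgl⟩ := exists_dual_of_norm_le Φ l hC fun v => (RCLike.norm_conj _).trans_le (h v)
  refine ⟨(InnerProductSpace.toDual 𝕜 H).symm g, (LinearIsometryEquiv.norm_map _ _).trans_le hg,
    fun v => ?_⟩
  rw [← inner_conj_symm, InnerProductSpace.toDual_symm_apply, hgl]
  exact RCLike.conj_conj _

theorem exists_mem_lt_volume_inter_Ici {A : Set ℝ} (hA : BddBelow A) {c σ : ℝ} (hc : 0 ≤ c)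
    (hσ : 0 ≤ σ) (hv : ENNReal.ofReal (c + σ) < volume A) :
    ∃ x ∈ A, ENNReal.ofReal c < volume (A ∩ Set.Ici (x + σ)) := by
  obtain ⟨r, -, hσr, hrA⟩ := ENNReal.lt_iff_exists_real_btwn.1 hv
  replace hσr := (ENNReal.ofReal_lt_ofReal_iff_of_nonneg (by positivity)).1 hσr
  obtain ⟨x, hx, hxr⟩ := exists_lt_of_csInf_lt (nonempty_of_measure_ne_zero (ne_bot_of_gt hv))
    (show sInf A < sInf A + (r - (c + σ)) by linarith)
  refine ⟨x, hx, ?_⟩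
  by_contra! hcon
  have hInf : sInf A ≤ x := csInf_le hA hx
  have hcover : A ⊆ (A ∩ Set.Ici (x + σ)) ∪ Set.Ico (sInf A) (x + σ) := fun y hy =>
    (le_or_gt (x + σ) y).imp (⟨hy, ·⟩) (⟨csInf_le hA hy, ·⟩)
  have hle : volume A ≤ ENNReal.ofReal c + ENNReal.ofReal (x + σ - sInf A) := by
    refine (measure_mono hcover).trans ((measure_union_le _ _).trans ?_)
    rw [Real.volume_Ico]
    gcongr
  rw [← ENNReal.ofReal_add hc (by linarith)] at hle
  exact absurd (hle.trans (ENNReal.ofReal_le_ofReal (by linarith))) (not_le.2 hrA)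

theorem exists_increasing_separated_points {σ : ℝ} (hσ : 0 ≤ σ) (n : ℕ) : ∀ A : Set ℝ,
    BddBelow A → ENNReal.ofReal (n * σ) < volume A → ∃ x : ℕ → ℝ, (∀ j < n, x j ∈ A) ∧
      ∀ i j, i < j → j < n → ((j : ℝ) - i) * σ ≤ x j - x i := by
  induction n with
  | zero => exact fun A _ _ => ⟨fun _ => 0, by simp, by simp⟩
  | succ n ih =>
    intro A hA hv
    rw [Nat.cast_succ, add_one_mul] at hv
    obtain ⟨x₀, hx₀, hvol⟩ := exists_mem_lt_volume_inter_Ici hA (by positivity) hσ hv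
    obtain ⟨x, hx, hsep⟩ := ih _ (hA.mono Set.inter_subset_left) hvol
    refine ⟨fun j => Nat.casesOn j x₀ x, ?_, ?_⟩
    · rintro (_ | j) hj
      · exact hx₀
      · exact (hx j (by omega)).1
    · rintro (_ | i) (_ | j) hij hj
      · omega
      · have hfirst : x₀ + σ ≤ x 0 := (hx 0 (by omega)).2
        have hrest : (j : ℝ) * σ ≤ x j - x 0 := by
          rcases j.eq_zero_or_pos with rfl | hj0
          · simp
          · simpa using hsep 0 j hj0 (by omega)
        push_cast
        change _ ≤ x j - x₀
        linarith
      · omega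
      · simpa using hsep i j (by omega) (by omega)

theorem exists_separated_points {σ : ℝ} (hσ : 0 ≤ σ) {n : ℕ} {A : Set ℝ} (hA : BddBelow A)
    (hv : ENNReal.ofReal (n * σ) < volume A) : ∃ x : ℕ → ℝ, (∀ j < n, x j ∈ A) ∧
      ∀ i < n, ∀ j < n, |(i : ℝ) - j| * σ ≤ |x i - x j| := by
  obtain ⟨x, hxA, hsep⟩ := exists_increasing_separated_points hσ n A hA hv
  refine ⟨x, hxA, fun i hi j hj => ?_⟩
  wlog hij : i ≤ j generalizing i j
  · rw [abs_sub_comm, abs_sub_comm (x i)]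
    exact this j hj i hi (by omega)
  rcases hij.eq_or_lt with rfl | hij
  · simp
  rw [abs_sub_comm, abs_sub_comm (x i), abs_of_pos (sub_pos.2 (Nat.cast_lt.2 hij))]
  exact (hsep i j hij hj).trans (le_abs_self _)

theorem prod_erase_abs_sub (i m : ℕ) :
    ∏ j ∈ (Finset.range (i + m + 1)).erase i, |(i : ℝ) - j| = (i.factorial * m.factorial : ℕ) := by
  induction m with
  | zero =>
    rw [add_zero, Finset.range_add_one, Finset.erase_insert (by simp), ← Finset.prod_range_reflect,
      Nat.factorial_zero, mul_one, ← Finset.prod_range_add_one_eq_factorial, Nat.cast_prod]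
    refine Finset.prod_congr rfl fun j hj => ?_
    have hji : j + 1 ≤ i := Finset.mem_range.1 hj
    rw [show i - 1 - j = i - (j + 1) by omega, Nat.cast_sub hji, sub_sub_cancel, Nat.abs_cast]
  | succ m ih =>
    rw [← add_assoc, Finset.range_add_one, Finset.erase_insert_of_ne (by omega),
      Finset.prod_insert (by simp), ih, Nat.factorial_succ, abs_sub_comm,
      abs_of_nonneg (by push_cast; linarith)]
    push_cast
    ring

section Lagrange

variable {n : ℕ} {x : ℕ → ℝ} {σ l y : ℝ}

theorem abs_eval_lagrange_basis_le (hσ : 0 < σ)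
    (hx : ∀ i < n + 1, ∀ j < n + 1, |(i : ℝ) - j| * σ ≤ |x i - x j|)
    (hy : ∀ j < n + 1, |y - x j| ≤ l) {i : ℕ} (hi : i < n + 1) :
    |(Lagrange.basis (Finset.range (n + 1)) x i).eval y| ≤
      (l / σ) ^ n * ((i.factorial * (n - i).factorial : ℕ) : ℝ)⁻¹ := by
  have hfactor : ∀ j ∈ (Finset.range (n + 1)).erase i,
      |(Lagrange.basisDivisor (x i) (x j)).eval y| ≤ l / σ * |(i : ℝ) - j|⁻¹ := by
    intro j hj
    obtain ⟨hji, hjn⟩ := Finset.mem_erase.1 hj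
    replace hjn := Finset.mem_range.1 hjn
    have hij : 0 < |(i : ℝ) - j| := abs_pos.2 (sub_ne_zero.2 (Nat.cast_injective.ne hji.symm))
    rw [Lagrange.basisDivisor, Polynomial.eval_mul, Polynomial.eval_C, Polynomial.eval_sub,
      Polynomial.eval_X, Polynomial.eval_C, abs_mul, abs_inv]
    calc |x i - x j|⁻¹ * |y - x j| ≤ (|(i : ℝ) - j| * σ)⁻¹ * l := by
          gcongr
          exacts [hx i hi j hjn, hy j hjn]
      _ = l / σ * |(i : ℝ) - j|⁻¹ := by field_simp
  rw [Lagrange.basis, Polynomial.eval_prod, Finset.abs_prod]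
  refine (Finset.prod_le_prod (fun _ _ => abs_nonneg _) hfactor).trans_eq ?_
  obtain ⟨m, rfl⟩ := Nat.exists_eq_add_of_le (Nat.lt_succ_iff.1 hi)
  rw [Finset.prod_mul_distrib, Finset.prod_const, Finset.prod_inv_distrib, prod_erase_abs_sub,
    Finset.card_erase_of_mem (Finset.mem_range.2 hi), Finset.card_range,
    Nat.succ_sub_one, Nat.add_sub_cancel_left]

theorem sum_abs_eval_lagrange_basis_le (hσ : 0 < σ)
    (hx : ∀ i < n + 1, ∀ j < n + 1, |(i : ℝ) - j| * σ ≤ |x i - x j|)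
    (hy : ∀ j < n + 1, |y - x j| ≤ l) :
    ∑ i ∈ Finset.range (n + 1), |(Lagrange.basis (Finset.range (n + 1)) x i).eval y| ≤
      (2 * l / σ) ^ n / n.factorial := by
  have hchoose : ∀ i ∈ Finset.range (n + 1),
      ((i.factorial * (n - i).factorial : ℕ) : ℝ)⁻¹ = (n.choose i : ℝ) / n.factorial := by
    intro i hi
    rw [← Nat.choose_mul_factorial_mul_factorial (Finset.mem_range_succ_iff.1 hi)]
    have := Nat.choose_pos (Finset.mem_range_succ_iff.1 hi)
    push_cast
    field_simp
  have hterm : ∀ i ∈ Finset.range (n + 1),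
      |(Lagrange.basis (Finset.range (n + 1)) x i).eval y| ≤
        (l / σ) ^ n * ((n.choose i : ℝ) / n.factorial) := fun i hi =>
    (abs_eval_lagrange_basis_le hσ hx hy (Finset.mem_range.1 hi)).trans_eq
      (by rw [hchoose i hi])
  refine (Finset.sum_le_sum hterm).trans_eq ?_
  rw [← Finset.mul_sum, ← Finset.sum_div, ← Nat.cast_sum, Nat.sum_range_choose]
  push_cast
  ring

end Lagrange

theorem abs_eval_le_sum_lagrange_basis {n : ℕ} {P : Polynomial ℝ} (hP : P.degree < n) {x : ℕ → ℝ}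
    (hx : Set.InjOn x (Finset.range n)) {ε : ℝ} (hε : ∀ i < n, |P.eval (x i)| ≤ ε) (y : ℝ) :
    |P.eval y| ≤ (∑ i ∈ Finset.range n, |(Lagrange.basis (Finset.range n) x i).eval y|) * ε := by
  rw [Lagrange.eq_interpolate (s := Finset.range n) (v := x) (f := P) hx (by simpa using hP),
    Lagrange.interpolate_apply, Polynomial.eval_finsetSum, Finset.sum_mul]
  refine (Finset.abs_sum_le_sum_abs _ _).trans (Finset.sum_le_sum fun i hi => ?_)
  rw [Polynomial.eval_mul, Polynomial.eval_C, abs_mul, mul_comm]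
  gcongr
  exact hε i (Finset.mem_range.1 hi)

theorem nat_pow_div_factorial_le (n : ℕ) :
    ((n + 1 : ℕ) : ℝ) ^ n / n.factorial ≤ 3 ^ (n + 1) := by
  calc ((n + 1 : ℕ) : ℝ) ^ n / n.factorial
      = ((n + 1 : ℕ) : ℝ) ^ (n + 1) / (n + 1).factorial := by
        rw [Nat.factorial_succ, pow_succ]
        push_cast
        field_simp
    _ ≤ Real.exp (n + 1 : ℕ) := Real.pow_div_factorial_le_exp _ (Nat.cast_nonneg _) _
    _ = Real.exp 1 ^ (n + 1) := by rw [← Real.exp_nat_mul, mul_one]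
    _ ≤ 3 ^ (n + 1) := by gcongr; exact Real.exp_one_lt_three.le

/-- A form of Remez' inequality: interpolate at `n` points of `A` at mutual distance `m / (2n)`. -/
theorem abs_eval_le_of_measure {n : ℕ} {P : Polynomial ℝ} (hP : P.degree < n) {a l m ε : ℝ}
    (hm : 0 < m) {A : Set ℝ} (hA : A ⊆ Set.Icc a (a + l)) (hv : ENNReal.ofReal m ≤ volume A)
    (hb : ∀ x ∈ A, |P.eval x| ≤ ε) {y : ℝ} (hy : y ∈ Set.Icc a (a + l)) :
    |P.eval y| ≤ (12 * l / m) ^ n * ε := by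
  have hml : m ≤ l := by
    have := hv.trans (measure_mono hA)
    rw [Real.volume_Icc, add_sub_cancel_left] at this
    exact (ENNReal.ofReal_le_ofReal_iff (by linarith [hy.1, hy.2])).1 this
  have hl : 0 < l := hm.trans_le hml
  obtain ⟨x₀, hx₀⟩ : A.Nonempty :=
    nonempty_of_measure_ne_zero ((ENNReal.ofReal_pos.2 hm).trans_le hv).ne'
  have hε : 0 ≤ ε := (abs_nonneg _).trans (hb x₀ hx₀)
  rcases n with _ | n
  · have hP0 : P = 0 := Polynomial.degree_eq_bot.1 (by simpa using hP)
    simpa [hP0] using hε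
  set σ : ℝ := m / (2 * (n + 1 : ℕ)) with hσ
  have hσ0 : 0 < σ := by positivity
  obtain ⟨x, hxA, hdist⟩ := exists_separated_points hσ0.le ⟨a, fun z hz => (hA hz).1⟩
    (((ENNReal.ofReal_lt_ofReal_iff hm).2 (by rw [hσ]; field_simp; norm_num)).trans_le hv)
  have hinj : Set.InjOn x (Finset.range (n + 1)) := by
    intro i hi j hj hij
    have hle := hdist i (Finset.mem_range.1 hi) j (Finset.mem_range.1 hj)
    rw [hij, sub_self, abs_zero] at hle
    have hzero := le_antisymm (nonpos_of_mul_nonpos_left hle hσ0) (abs_nonneg _)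
    exact Nat.cast_injective (sub_eq_zero.1 (abs_eq_zero.1 hzero))
  have hyx : ∀ j < n + 1, |y - x j| ≤ l := fun j hj => by
    have := hA (hxA j hj)
    rw [abs_le]
    constructor <;> linarith [this.1, this.2, hy.1, hy.2]
  refine (abs_eval_le_sum_lagrange_basis hP hinj (fun i hi => hb _ (hxA i hi)) y).trans ?_
  gcongr
  calc _ ≤ (2 * l / σ) ^ n / n.factorial := sum_abs_eval_lagrange_basis_le hσ0 hdist hyx
    _ = (4 * l / m) ^ n * (((n + 1 : ℕ) : ℝ) ^ n / n.factorial) := by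
        rw [← mul_div_assoc, ← mul_pow, hσ]
        congr 2
        field_simp
        ring
    _ ≤ (4 * l / m) ^ (n + 1) * 3 ^ (n + 1) := by
        have : 1 ≤ 4 * l / m := (one_le_div hm).2 (by linarith)
        gcongr
        exacts [n.le_succ, nat_pow_div_factorial_le n]
    _ = (12 * l / m) ^ (n + 1) := by rw [← mul_pow]; ring

/-- On the real interval `|x - c| < R`, the function `g` is the real part of a holomorphic function
on the complex disc of radius `R` about `c` which is bounded by `M` there. Only real parts are
recorded because the scalar field of the semigroup may be `ℝ`. -/
def HasHolomorphicExtension (g : ℝ → ℝ) (c R M : ℝ) : Prop :=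
  ∃ H : ℂ → ℂ, DifferentiableOn ℂ H (Metric.ball (c : ℂ) R) ∧
    (∀ z ∈ Metric.ball (c : ℂ) R, ‖H z‖ ≤ M) ∧
    ∀ x : ℝ, (x : ℂ) ∈ Metric.ball (c : ℂ) R → (H x).re = g x

theorem ofReal_mem_ball_ofReal {x c R : ℝ} : (x : ℂ) ∈ Metric.ball (c : ℂ) R ↔ |x - c| < R := by
  rw [Metric.mem_ball, Complex.dist_eq, ← Complex.ofReal_sub, Complex.norm_real, Real.norm_eq_abs]

theorem norm_iteratedDeriv_div_factorial_le {H : ℂ → ℂ} {c : ℂ} {R M : ℝ} (hR : 0 < R)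
    (hd : DifferentiableOn ℂ H (Metric.ball c (2 * R)))
    (hM : ∀ z ∈ Metric.ball c (2 * R), ‖H z‖ ≤ M) (j : ℕ) :
    ‖(j.factorial : ℂ)⁻¹ * iteratedDeriv j H c‖ ≤ M / R ^ j := by
  have hsub : Metric.closedBall c R ⊆ Metric.ball c (2 * R) :=
    Metric.closedBall_subset_ball (by linarith)
  have hcont : DiffContOnCl ℂ H (Metric.ball c R) := DifferentiableOn.diffContOnCl (by
    rw [closure_ball _ hR.ne']; exact hd.mono hsub)
  rw [norm_mul, norm_inv, RCLike.norm_natCast, inv_mul_le_iff₀ (by positivity), mul_div_assoc']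
  exact Complex.norm_iteratedDeriv_le_of_forall_mem_sphere_norm_le j hR hcont
    fun z hz => hM z (hsub (Metric.sphere_subset_closedBall hz))

theorem norm_sub_taylor_le {H : ℂ → ℂ} {c : ℂ} {R M : ℝ} (hR : 0 < R)
    (hd : DifferentiableOn ℂ H (Metric.ball c (2 * R)))
    (hM : ∀ z ∈ Metric.ball c (2 * R), ‖H z‖ ≤ M) (n : ℕ) {q : ℝ} (hq : q ≤ 1 / 2) {z : ℂ}
    (hz : ‖z - c‖ ≤ q * R) :
    ‖H z - ∑ j ∈ Finset.range n, (j.factorial : ℂ)⁻¹ * iteratedDeriv j H c * (z - c) ^ j‖ ≤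
      2 * M * q ^ n := by
  have hM0 : 0 ≤ M := (norm_nonneg _).trans (hM c (by simpa using hR))
  have hq0 : 0 ≤ q := nonneg_of_mul_nonneg_left ((norm_nonneg _).trans hz) hR
  have hzb : z ∈ Metric.ball c (2 * R) := by
    rw [Metric.mem_ball, Complex.dist_eq]
    nlinarith
  have htaylor : HasSum (fun j => (j.factorial : ℂ)⁻¹ * iteratedDeriv j H c * (z - c) ^ j)
      (H z) := by
    refine (Complex.hasSum_taylorSeries_on_ball hd hzb).congr_fun fun j => ?_
    simp only [smul_eq_mul]
    ring
  have hgeom : HasSum (fun j : ℕ => M * q ^ n * q ^ j) (M * q ^ n * (1 - q)⁻¹) :=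
    (hasSum_geometric_of_lt_one hq0 (by linarith)).mul_left _
  have htail := ((hasSum_nat_add_iff' n).2 htaylor).norm_le_of_bounded hgeom fun j => by
    rw [norm_mul, norm_pow, mul_assoc, ← pow_add]
    calc _ ≤ M / R ^ (j + n) * (q * R) ^ (j + n) := by
          gcongr; exact norm_iteratedDeriv_div_factorial_le hR hd hM _
      _ = M * q ^ (n + j) := by rw [mul_pow, add_comm]; field_simp
  refine htail.trans ?_
  have : (1 - q)⁻¹ ≤ 2 := by
    rw [inv_le_comm₀ (by linarith) (by norm_num)]
    linarith
  calc _ ≤ M * q ^ n * 2 := by gcongr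
    _ = 2 * M * q ^ n := by ring

namespace HasHolomorphicExtension

variable {g g₁ g₂ : ℝ → ℝ} {c R M : ℝ}

theorem mono (h : HasHolomorphicExtension g c R M) {R' M' : ℝ} (hR : R' ≤ R) (hM : M ≤ M') :
    HasHolomorphicExtension g c R' M' := by
  obtain ⟨H, hd, hb, hH⟩ := h
  have hsub := Metric.ball_subset_ball (x := (c : ℂ)) hR
  exact ⟨H, hd.mono hsub, fun z hz => (hb z (hsub hz)).trans hM, fun x hx => hH x (hsub hx)⟩

theorem congr (h : HasHolomorphicExtension g₁ c R M) (hg : ∀ x, |x - c| < R → g₁ x = g₂ x) :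
    HasHolomorphicExtension g₂ c R M := by
  obtain ⟨H, hd, hb, hH⟩ := h
  exact ⟨H, hd, hb, fun x hx => (hH x hx).trans (hg x (ofReal_mem_ball_ofReal.1 hx))⟩

theorem add {M₁ M₂ : ℝ} (h₁ : HasHolomorphicExtension g₁ c R M₁)
    (h₂ : HasHolomorphicExtension g₂ c R M₂) :
    HasHolomorphicExtension (fun x => g₁ x + g₂ x) c R (M₁ + M₂) := by
  obtain ⟨H₁, hd₁, hb₁, hH₁⟩ := h₁
  obtain ⟨H₂, hd₂, hb₂, hH₂⟩ := h₂
  exact ⟨fun z => H₁ z + H₂ z, hd₁.add hd₂, fun z hz => norm_add_le_of_le (hb₁ z hz) (hb₂ z hz),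
    fun x hx => by rw [Complex.add_re, hH₁ x hx, hH₂ x hx]⟩

theorem hasDerivAt_of_re_eq {H : ℂ → ℂ} (hd : DifferentiableOn ℂ H (Metric.ball (c : ℂ) R))
    (hH : ∀ x : ℝ, (x : ℂ) ∈ Metric.ball (c : ℂ) R → (H x).re = g x) {x : ℝ}
    (hx : (x : ℂ) ∈ Metric.ball (c : ℂ) R) : HasDerivAt g (deriv H x).re x := by
  have hball := Metric.isOpen_ball.mem_nhds hx
  refine (hd.differentiableAt hball).hasDerivAt.real_of_complex.congr_of_eventuallyEq ?_
  filter_upwards [Complex.continuous_ofReal.continuousAt.preimage_mem_nhds hball] with y hy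
  exact (hH y hy).symm

theorem differentiableAt (h : HasHolomorphicExtension g c R M) {x : ℝ} (hx : |x - c| < R) :
    DifferentiableAt ℝ g x := by
  obtain ⟨H, hd, -, hH⟩ := h
  exact (hasDerivAt_of_re_eq hd hH (ofReal_mem_ball_ofReal.2 hx)).differentiableAt

theorem deriv (h : HasHolomorphicExtension g c R M) (hR : 0 < R) :
    HasHolomorphicExtension (deriv g) c (R / 2) (M / (R / 2)) := by
  obtain ⟨H, hd, hb, hH⟩ := h
  have hsub : Metric.ball (c : ℂ) (R / 2) ⊆ Metric.ball (c : ℂ) R :=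
    Metric.ball_subset_ball (by linarith)
  refine ⟨_root_.deriv H, (hd.deriv Metric.isOpen_ball).mono hsub, fun z hz => ?_,
    fun x hx => (hasDerivAt_of_re_eq hd hH (hsub hx)).deriv.symm⟩
  have hclosed : Metric.closedBall z (R / 2) ⊆ Metric.ball (c : ℂ) R :=
    Metric.closedBall_subset_ball' (by linarith [Metric.mem_ball.1 hz])
  refine Complex.norm_deriv_le_of_forall_mem_sphere_norm_le (by positivity)
    (DifferentiableOn.diffContOnCl ?_)
    fun w hw => hb w (hclosed (Metric.sphere_subset_closedBall hw))
  rw [closure_ball _ (by positivity)]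
  exact hd.mono hclosed

theorem exists_polynomial_approx (h : HasHolomorphicExtension g c (2 * R) M) (hR : 0 < R) (n : ℕ) :
    ∃ P : Polynomial ℝ, P.degree < n ∧ ∀ q ≤ 1 / 2, ∀ x, |x - c| ≤ q * R →
      |g x - P.eval x| ≤ 2 * M * q ^ n := by
  obtain ⟨H, hd, hb, hH⟩ := h
  set a : ℕ → ℂ := fun j => (j.factorial : ℂ)⁻¹ * iteratedDeriv j H c
  refine ⟨∑ j ∈ Finset.range n, Polynomial.C (a j).re * (Polynomial.X - Polynomial.C c) ^ j,
    ?_, fun q hq x hx => ?_⟩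
  · refine (Polynomial.degree_sum_le _ _).trans_lt
      ((Finset.sup_lt_iff (WithBot.bot_lt_coe n)).2 fun j hj => ?_)
    rw [← Polynomial.smul_eq_C_mul]
    refine (Polynomial.degree_smul_le _ _).trans_lt ?_
    rw [Polynomial.degree_pow, Polynomial.degree_X_sub_C, nsmul_eq_mul, mul_one]
    exact Nat.cast_lt.2 (Finset.mem_range.1 hj)
  · have hre : g x - Polynomial.eval x (∑ j ∈ Finset.range n,
        Polynomial.C (a j).re * (Polynomial.X - Polynomial.C c) ^ j) =
        (H x - ∑ j ∈ Finset.range n, a j * ((x : ℂ) - c) ^ j).re := by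
      have hxb : (x : ℂ) ∈ Metric.ball (c : ℂ) (2 * R) :=
        ofReal_mem_ball_ofReal.2 (hx.trans_lt (by nlinarith))
      rw [Complex.sub_re, hH x hxb, Complex.re_sum, Polynomial.eval_finsetSum]
      congr 1
      refine Finset.sum_congr rfl fun j _ => ?_
      rw [← Complex.ofReal_sub, ← Complex.ofReal_pow, Complex.re_mul_ofReal]
      simp
    rw [hre]
    refine (Complex.abs_re_le_norm _).trans (norm_sub_taylor_le hR hd hb n hq ?_)
    rwa [← Complex.ofReal_sub, Complex.norm_real, Real.norm_eq_abs]

theorem abs_le_of_measure (h : HasHolomorphicExtension g c (2 * R) M) (hR : 0 < R) (n : ℕ)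
    {q ε : ℝ} (hq : 0 < q) (hq2 : q ≤ 1 / 2) {A : Set ℝ} (hA : A ⊆ Set.Icc (c - q * R) c)
    (hv : ENNReal.ofReal (q * R / 4) ≤ volume A) (hb : ∀ x ∈ A, |g x| ≤ ε) {y : ℝ}
    (hy : y ∈ Set.Icc (c - q * R) c) : |g y| ≤ 48 ^ n * ε + 4 * M * (48 * q) ^ n := by
  obtain ⟨P, hP, happ⟩ := h.exists_polynomial_approx hR n
  have hM : 0 ≤ M := by
    obtain ⟨H, -, hHM, -⟩ := h
    exact (norm_nonneg _).trans (hHM c (Metric.mem_ball_self (by positivity)))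
  have hgP : ∀ x ∈ Set.Icc (c - q * R) c, |g x - P.eval x| ≤ 2 * M * q ^ n := fun x hx =>
    happ q hq2 x (by rw [abs_le]; constructor <;> nlinarith [hx.1, hx.2])
  have hPA : ∀ x ∈ A, |P.eval x| ≤ ε + 2 * M * q ^ n := fun x hx => by
    have h1 := abs_le.1 (hgP x (hA hx))
    have h2 := abs_le.1 (hb x hx)
    rw [abs_le]
    constructor <;> linarith
  have hPy := abs_eval_le_of_measure hP (a := c - q * R) (l := q * R) (by positivity)
    (by simpa using hA) hv hPA (y := y) (by simpa using hy)
  have hconst : 12 * (q * R) / (q * R / 4) = 48 := by field_simp; norm_num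
  rw [hconst] at hPy
  calc |g y| = |(g y - P.eval y) + P.eval y| := by rw [sub_add_cancel]
    _ ≤ 2 * M * q ^ n + 48 ^ n * (ε + 2 * M * q ^ n) :=
        (abs_add_le _ _).trans (add_le_add (hgP y hy) hPy)
    _ ≤ 2 * M * (48 * q) ^ n + 48 ^ n * (ε + 2 * M * q ^ n) := by gcongr; linarith
    _ = 48 ^ n * ε + 4 * M * (48 * q) ^ n := by rw [mul_pow]; ring

end HasHolomorphicExtension

theorem exists_ball_subset_openSector {θ : ℝ} (hθ : 0 < θ) :
    ∃ r : ℝ, 0 < r ∧ r < 1 ∧ ∀ s : ℝ, 0 < s → Metric.ball (s : ℂ) (r * s) ⊆ openSector θ := by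
  have harg : Tendsto (fun z : ℂ => |z.arg|) (𝓝 1) (𝓝 0) := by
    simpa using (Complex.continuousAt_arg Complex.one_mem_slitPlane).tendsto.abs
  obtain ⟨r, hr, hball⟩ := Metric.eventually_nhds_iff_ball.1 (harg.eventually_lt_const hθ)
  refine ⟨min r (1 / 2), by positivity, (min_le_right _ _).trans_lt (by norm_num),
    fun s hs z hz => ?_⟩
  have hs0 : (s : ℂ) ≠ 0 := Complex.ofReal_ne_zero.2 hs.ne'
  have hscale : dist (z / s) 1 < min r (1 / 2) := by
    rw [Metric.mem_ball, dist_eq_norm] at hz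
    rw [dist_eq_norm, div_sub_one hs0, norm_div, Complex.norm_real, Real.norm_of_nonneg hs.le,
      div_lt_iff₀ hs]
    exact hz
  constructor
  · rintro rfl
    rw [zero_div, dist_zero_left, norm_one] at hscale
    linarith [min_le_right r (1 / 2)]
  · rw [← mul_div_cancel₀ z hs0, Complex.arg_real_mul _ hs]
    exact hball _ (hscale.trans_le (min_le_left _ _))

theorem ofReal_mem_openSector {θ t : ℝ} (hθ : 0 < θ) (ht : 0 < t) : (t : ℂ) ∈ openSector θ :=
  ⟨Complex.ofReal_ne_zero.2 ht.ne', by rwa [Complex.arg_ofReal_of_nonneg ht.le, abs_zero]⟩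

theorem isOpen_openSector {θ : ℝ} (hθ : θ ≤ Real.pi) : IsOpen (openSector θ) := by
  rw [isOpen_iff_mem_nhds]
  rintro z ⟨hz, hzθ⟩
  have hslit : z ∈ Complex.slitPlane := Complex.mem_slitPlane_iff_arg.2
    ⟨fun h => (hzθ.trans_le (hθ.trans_eq h.symm)).not_ge (le_abs_self _), hz⟩
  filter_upwards [(Complex.continuousAt_arg hslit).abs.eventually_lt continuousAt_const hzθ,
    isOpen_ne.mem_nhds hz] with w hw hw0 using ⟨hw0, hw⟩

theorem IsSectorialSemigroup.exists_norm_le {Y : Type*} [NormedAddCommGroup Y] [NormedSpace ℂ Y]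
    [CompleteSpace Y] {θ : ℝ} {T : ℂ → Y →L[ℂ] Y} (hT : IsSectorialSemigroup θ T) :
    ∃ δ C : ℝ, 0 < δ ∧ 0 < C ∧ ∀ z ∈ openSector θ, ‖z‖ < δ → ‖T z‖ ≤ C := by
  by_contra! hcon
  have hex : ∀ n : ℕ, ∃ z ∈ openSector θ, ‖z‖ < 1 / ((n : ℝ) + 1) ∧ (n : ℝ) + 1 < ‖T z‖ :=
    fun n => hcon _ _ (by positivity) (by positivity)
  choose z hz hzn hTz using hex
  have hlim : Tendsto z atTop (𝓝[openSector θ] 0) :=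
    tendsto_nhdsWithin_iff.2 ⟨squeeze_zero_norm (fun n => (hzn n).le)
      tendsto_one_div_add_atTop_nhds_zero_nat, Eventually.of_forall hz⟩
  obtain ⟨C, hC⟩ := banach_steinhaus (g := fun n => T (z n)) fun y => by
    obtain ⟨C, hC⟩ := ((hT.tendsto y).comp hlim).norm.bddAbove_range
    exact ⟨C, fun n => hC ⟨n, rfl⟩⟩
  obtain ⟨n, hn⟩ := exists_nat_gt C
  linarith [hTz n, hC n]

theorem ofReal_half_le_measure_le_average {α : Type*} [MeasurableSpace α] {μ : Measure α}
    {A : Set α} {g : α → ℝ} (hg : IntegrableOn g A μ) (hg0 : ∀ x, 0 ≤ g x) {m : ℝ} (hm : 0 < m)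
    (hv : ENNReal.ofReal m ≤ μ A) :
    ENNReal.ofReal (m / 2) ≤ μ {x ∈ A | g x ≤ 2 / m * ∫ y in A, g y ∂μ} := by
  set I := ∫ y in A, g y ∂μ with hI
  have hI0 : 0 ≤ I := integral_nonneg hg0
  have hbad : μ {x ∈ A | 2 / m * I < g x} ≤ ENNReal.ofReal (m / 2) := by
    have hle : μ {x ∈ A | 2 / m * I < g x} ≤ μ.restrict A {x | 2 / m * I < g x} :=
      (measure_mono (Set.inter_comm A _).subset).trans (Measure.le_restrict_apply A _)
    by_cases h0 : μ.restrict A {x | 2 / m * I < g x} = 0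
    · exact (hle.trans_eq h0).trans zero_le
    have hlt := (setIntegral_gt_gt (by positivity : 0 ≤ 2 / m * I) hg.integrableOn h0).trans_le
      (setIntegral_le_integral hg (ae_of_all _ hg0))
    rw [← hI, ← mul_assoc] at hlt
    have hIpos : 0 < I := hI0.lt_of_ne' fun h => by simp [h] at hlt
    have hreal : (μ.restrict A).real {x | 2 / m * I < g x} ≤ m / 2 := by
      have h1 := (mul_lt_iff_lt_one_left hIpos).1 hlt
      rw [mul_div_assoc', div_lt_one hm] at h1
      linarith
    have hfin : μ.restrict A {x | 2 / m * I < g x} ≠ ⊤ :=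
      (hg.measure_gt_lt_top (by positivity)).ne
    exact hle.trans ((ENNReal.le_ofReal_iff_toReal_le hfin (by positivity)).2 hreal)
  have hsplit : A ⊆ {x ∈ A | g x ≤ 2 / m * I} ∪ {x ∈ A | 2 / m * I < g x} := fun x hx =>
    (le_or_gt (g x) (2 / m * I)).imp (⟨hx, ·⟩) (⟨hx, ·⟩)
  have hsum := hv.trans ((measure_mono hsplit).trans (measure_union_le _ _))
  have hhalf : ENNReal.ofReal m = ENNReal.ofReal (m / 2) + ENNReal.ofReal (m / 2) := by
    rw [← ENNReal.ofReal_add (by positivity) (by positivity), add_halves]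
  rw [hhalf] at hsum
  exact ENNReal.le_of_add_le_add_right ENNReal.ofReal_ne_top (hsum.trans (by gcongr))

theorem exists_density_point {E : Set ℝ} (hE : MeasurableSet E) (hE0 : volume E ≠ 0) {η : ℝ}
    (hη : 0 < η) : ∃ l ∈ E, ∀ᶠ h in 𝓝[>] (0 : ℝ),
      volume (Set.Icc l (l + h) \ E) ≤ ENNReal.ofReal (η * h) := by
  have : (ae (volume.restrict E)).NeBot := by rwa [ae_neBot, Ne, Measure.restrict_eq_zero]
  obtain ⟨l, hl, hlE⟩ := ((ae_restrict_of_ae (s := E)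
    (Besicovitch.ae_tendsto_measure_inter_div_of_measurableSet volume hE.compl)).and
      (ae_restrict_mem hE)).exists
  rw [Set.indicator_of_notMem (by simpa using hlE)] at hl
  have hη2 : (0 : ENNReal) < ENNReal.ofReal (η / 2) := by simpa using hη
  refine ⟨l, hlE, ?_⟩
  filter_upwards [hl.eventually_lt_const hη2, self_mem_nhdsWithin] with h hlt hh
  rw [Real.volume_closedBall,
    ENNReal.div_lt_iff (.inl <| by simpa using hh) (.inl ENNReal.ofReal_ne_top),
    ← ENNReal.ofReal_mul (by positivity), show η / 2 * (2 * h) = η * h by ring] at hlt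
  have hsub : Set.Icc l (l + h) \ E ⊆ Eᶜ ∩ Metric.closedBall l h := by
    rw [Real.closedBall_eq_Icc, Set.sdiff_eq, Set.inter_comm]
    have : (0 : ℝ) < h := hh
    gcongr
    linarith
  exact (measure_mono hsub).trans hlt.le

/-- An interpolation estimate for a quantity `F` evolving in time, observed through `g`: on a time
interval of length `L < δ`, the final value is controlled by the integral of `g` over any set
filling at least half of the last fraction `κ` of the interval, with a free exponent `n` weighting
that integral against the initial value. -/
def InterpolationEstimate (κ δ Λ : ℝ) (cost F g : ℝ → ℝ) : Prop :=
  ∀ (n : ℕ) (t L : ℝ), 0 ≤ t → 0 < L → L < δ → ∀ A, MeasurableSet A →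
    A ⊆ Set.Icc (t + L - κ * L) (t + L) → ENNReal.ofReal (κ * L / 2) ≤ volume A →
      F (t + L) ≤ cost L * (Λ ^ n * (∫ x in A, g x) + ((Λ ^ n) ^ 2)⁻¹ * F t)

-- With `ρ ^ k = 1 / 2`, refining the scale by `ρ` doubles the exponent of the cost.
theorem exists_exp_div_rpow_le_pow {Λ c D k ℓ ρ : ℝ} (hΛ : 1 < Λ) (hD : 0 ≤ D) (hℓ : 0 < ℓ)
    (hρ0 : 0 < ρ) (hρ1 : ρ < 1) (hρ : ρ ^ k = 1 / 2) :
    ∃ N : ℕ, 0 < N ∧ ∀ m : ℕ,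
      c * Real.exp (D / (ℓ * ρ ^ (m + 1)) ^ k) / (ℓ * ρ ^ (m + 1)) ≤ Λ ^ (N * 2 ^ m) := by
  obtain ⟨a, ha1, hca⟩ : ∃ a : ℝ, 1 ≤ a ∧ c / ℓ ≤ a := ⟨_, le_max_left _ _, le_max_right _ _⟩
  have hρi : 1 < ρ⁻¹ := (one_lt_inv₀ hρ0).2 hρ1
  have hE1 : 1 ≤ Real.exp (2 * (D / ℓ ^ k)) := Real.one_le_exp (by positivity)
  obtain ⟨N, hN⟩ := pow_unbounded_of_one_lt (a * Real.exp (2 * (D / ℓ ^ k)) * ρ⁻¹) hΛ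
  have hN0 : N ≠ 0 := by
    rintro rfl
    have := one_le_mul_of_one_le_of_one_le (one_le_mul_of_one_le_of_one_le ha1 hE1) hρi.le
    rw [pow_zero] at hN
    linarith
  refine ⟨N, hN0.bot_lt, fun m => ?_⟩
  have hexp : D / (ℓ * ρ ^ (m + 1)) ^ k = ((2 ^ m : ℕ) : ℝ) * (2 * (D / ℓ ^ k)) := by
    rw [Real.mul_rpow hℓ.le (by positivity), ← Real.rpow_natCast ρ, ← Real.rpow_mul hρ0.le,
      mul_comm _ k, Real.rpow_mul hρ0.le, hρ, Real.rpow_natCast, one_div, inv_pow]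
    push_cast
    field_simp
    ring
  calc c * Real.exp (D / (ℓ * ρ ^ (m + 1)) ^ k) / (ℓ * ρ ^ (m + 1))
      = c / ℓ * Real.exp (2 * (D / ℓ ^ k)) ^ 2 ^ m * ρ⁻¹ ^ (m + 1) := by
        rw [hexp, Real.exp_nat_mul, inv_pow]
        field_simp
    _ ≤ a ^ 2 ^ m * Real.exp (2 * (D / ℓ ^ k)) ^ 2 ^ m * ρ⁻¹ ^ 2 ^ m := by
        gcongr
        · exact hca.trans (le_self_pow₀ ha1 (by positivity))
        · exact hρi.le
        · exact Nat.lt_two_pow_self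
    _ = (a * Real.exp (2 * (D / ℓ ^ k)) * ρ⁻¹) ^ 2 ^ m := by rw [mul_pow, mul_pow]
    _ ≤ Λ ^ (N * 2 ^ m) := by
        rw [pow_mul]
        gcongr

theorem exists_telescoping_weights {Λ : ℝ} (hΛ : 1 < Λ) {cost : ℕ → ℝ} (hcost : ∀ m, 1 ≤ cost m)
    {N : ℕ} (hN : 0 < N) (hgrowth : ∀ m, cost (m + 1) ≤ Λ ^ (N * 2 ^ m)) :
    ∃ (w : ℕ → ℝ) (n : ℕ → ℕ), (∀ m, 0 < w m) ∧ Tendsto w atTop (𝓝 0) ∧ ∀ m,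
      w m * cost m * Λ ^ n m ≤ 1 ∧ w m * cost m * ((Λ ^ n m) ^ 2)⁻¹ ≤ w (m + 1) := by
  have : 0 < Λ := by linarith
  have hcost0 : ∀ m, 0 < cost m := fun m => by linarith [hcost m]
  refine ⟨fun m => (cost m * Λ ^ (N * 2 ^ m))⁻¹, fun m => N * 2 ^ m,
    fun m => by have := hcost0 m; positivity, ?_, fun m => ⟨?_, ?_⟩⟩
  · refine Tendsto.inv_tendsto_atTop (tendsto_atTop_mono (fun m => ?_)
      (tendsto_pow_atTop_atTop_of_one_lt hΛ))
    calc Λ ^ m ≤ Λ ^ (N * 2 ^ m) :=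
          pow_le_pow_right₀ hΛ.le (Nat.lt_two_pow_self.le.trans (Nat.le_mul_of_pos_left _ hN))
      _ ≤ cost m * Λ ^ (N * 2 ^ m) := le_mul_of_one_le_left (by positivity) (hcost m)
  · have := hcost0 m
    exact le_of_eq (by field_simp)
  · have := hcost0 m
    have := hcost0 (m + 1)
    calc (cost m * Λ ^ (N * 2 ^ m))⁻¹ * cost m * ((Λ ^ (N * 2 ^ m)) ^ 2)⁻¹
        = (Λ ^ (N * 2 ^ m) * Λ ^ (N * 2 ^ (m + 1)))⁻¹ := by
          rw [pow_succ 2 m, ← mul_assoc, pow_mul _ _ 2]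
          field_simp
      _ ≤ (cost (m + 1) * Λ ^ (N * 2 ^ (m + 1)))⁻¹ := by
          gcongr
          exact hgrowth m

theorem le_setIntegral_of_telescoping {E : Set ℝ} (hE : MeasurableSet E) {g : ℝ → ℝ}
    (hg : IntegrableOn g E) (hg0 : ∀ t, 0 ≤ g t) {τ : ℕ → ℝ} (hτ : Antitone τ) {a : ℕ → ℝ}
    (ha : Tendsto a atTop (𝓝 0))
    (hstep : ∀ m, a m ≤ (∫ t in E ∩ Set.Ioc (τ (m + 1)) (τ m), g t) + a (m + 1)) :
    a 0 ≤ ∫ t in E, g t := by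
  have hmeas : ∀ x y : ℝ, MeasurableSet (E ∩ Set.Ioc x y) := fun _ _ =>
    hE.inter measurableSet_Ioc
  have hpartial : ∀ m, a 0 ≤ (∫ t in E ∩ Set.Ioc (τ m) (τ 0), g t) + a m := by
    intro m
    induction m with
    | zero => simp
    | succ m ih =>
      rw [← Set.Ioc_union_Ioc_eq_Ioc (hτ m.le_succ) (hτ m.zero_le), Set.inter_union_distrib_left,
        setIntegral_union ((Set.Ioc_disjoint_Ioc_of_le le_rfl).mono Set.inter_subset_right
          Set.inter_subset_right) (hmeas _ _) (hg.mono_set Set.inter_subset_left)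
          (hg.mono_set Set.inter_subset_left)]
      linarith [hstep m]
  have hlim : Tendsto (fun m => (∫ t in E, g t) + a m) atTop (𝓝 (∫ t in E, g t)) := by
    simpa using ha.const_add (∫ t in E, g t)
  refine ge_of_tendsto' hlim fun m => (hpartial m).trans ?_
  exact add_le_add_left
    (setIntegral_mono_set hg (ae_of_all _ hg0) Set.inter_subset_left.eventuallyLE) _

theorem ofReal_le_volume_inter_Ioc {E : Set ℝ} {l u m : ℝ} (hm : 0 ≤ m) (hl : l ≤ u - 2 * m)
    (h : volume (Set.Icc l u \ E) ≤ ENNReal.ofReal m) :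
    ENNReal.ofReal m ≤ volume (E ∩ Set.Ioc (u - 2 * m) u) := by
  have hcover : Set.Ioc (u - 2 * m) u ⊆ E ∩ Set.Ioc (u - 2 * m) u ∪ Set.Icc l u \ E :=
    fun x hx => (em (x ∈ E)).imp (⟨·, hx⟩) (⟨⟨hl.trans hx.1.le, hx.2⟩, ·⟩)
  have hsum := (measure_mono hcover).trans (measure_union_le (μ := volume) _ _)
  rw [Real.volume_Ioc, show u - (u - 2 * m) = m + m by ring, ENNReal.ofReal_add hm hm] at hsum
  exact ENNReal.le_of_add_le_add_right ENNReal.ofReal_ne_top (hsum.trans (by gcongr))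

theorem InterpolationEstimate.mul_le_setIntegral_add {κ δ Λ : ℝ} {cost F g : ℝ → ℝ}
    (h : InterpolationEstimate κ δ Λ cost F g) (hκ0 : 0 < κ) (hκ1 : κ ≤ 1) (hF : ∀ t, 0 ≤ F t)
    {E : Set ℝ} (hE : MeasurableSet E) (hg : IntegrableOn g E) (hg0 : ∀ t, 0 ≤ g t)
    {l t L : ℝ} (hl : l ≤ t) (ht : 0 ≤ t) (hL : 0 < L) (hLδ : L < δ)
    (hdens : volume (Set.Icc l (t + L) \ E) ≤ ENNReal.ofReal (κ * L / 2))
    {w w' : ℝ} {n : ℕ} (hw : 0 ≤ w) (hn : w * cost L * Λ ^ n ≤ 1)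
    (hn' : w * cost L * ((Λ ^ n) ^ 2)⁻¹ ≤ w') :
    w * F (t + L) ≤ (∫ s in E ∩ Set.Ioc t (t + L), g s) + w' * F t := by
  have hκL : κ * L ≤ L := mul_le_of_le_one_left hL.le hκ1
  set A := E ∩ Set.Ioc (t + L - κ * L) (t + L)
  have hvol : ENNReal.ofReal (κ * L / 2) ≤ volume A := by
    have := ofReal_le_volume_inter_Ioc (by positivity) (by linarith) hdens
    rwa [mul_div_cancel₀ _ two_ne_zero] at this
  have hmono : ∫ s in A, g s ≤ ∫ s in E ∩ Set.Ioc t (t + L), g s := by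
    refine setIntegral_mono_set (hg.mono_set Set.inter_subset_left) (ae_of_all _ hg0)
      (Set.inter_subset_inter_right E (Set.Ioc_subset_Ioc_left ?_)).eventuallyLE
    linarith
  have hI0 : 0 ≤ ∫ s in A, g s := integral_nonneg hg0
  calc w * F (t + L)
      ≤ w * (cost L * (Λ ^ n * (∫ s in A, g s) + ((Λ ^ n) ^ 2)⁻¹ * F t)) := by
        gcongr
        exact h n t L ht hL hLδ A (hE.inter measurableSet_Ioc)
          (Set.inter_subset_right.trans Set.Ioc_subset_Icc_self) hvol
    _ = w * cost L * Λ ^ n * (∫ s in A, g s) + w * cost L * ((Λ ^ n) ^ 2)⁻¹ * F t := by ring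
    _ ≤ 1 * (∫ s in A, g s) + w' * F t := by
        gcongr
        exact hF t
    _ ≤ (∫ s in E ∩ Set.Ioc t (t + L), g s) + w' * F t := by rw [one_mul]; gcongr

theorem exists_geometric_times {E : Set ℝ} (hE : MeasurableSet E) (hE0 : volume E ≠ 0) {T : ℝ}
    (hET : E ⊆ Set.Ioo 0 T) {κ δ ρ : ℝ} (hκ : 0 < κ) (hδ : 0 < δ) (hρ0 : 0 < ρ) (hρ1 : ρ < 1) :
    ∃ (l ℓ : ℝ) (τ : ℕ → ℝ), 0 < l ∧ 0 < ℓ ∧ ℓ < δ ∧ ∀ m, l ≤ τ m ∧ τ m ≤ T ∧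
      τ (m + 1) + ℓ * ρ ^ m = τ m ∧
      volume (Set.Icc l (τ m) \ E) ≤ ENNReal.ofReal (κ * (ℓ * ρ ^ m) / 2) := by
  have : 0 < 1 - ρ := sub_pos.2 hρ1
  obtain ⟨l, hlE, hdens⟩ := exists_density_point hE hE0 (η := κ * (1 - ρ) / 2) (by positivity)
  obtain ⟨hl0, hlT⟩ := hET hlE
  obtain ⟨a, ha0 : 0 < a, ha⟩ := mem_nhdsGT_iff_exists_Ioc_subset.1
    (hdens.and (Ioo_mem_nhdsGT (lt_min (sub_pos.2 hlT) hδ)))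
  obtain ⟨haT, haδ⟩ := lt_min_iff.1 (ha (Set.right_mem_Ioc.2 ha0)).2.2
  refine ⟨l, a * (1 - ρ), fun m => l + a * ρ ^ m, hl0, by positivity, by nlinarith, fun m => ?_⟩
  have hpos : 0 < a * ρ ^ m := by positivity
  have hle : a * ρ ^ m ≤ a := mul_le_of_le_one_right ha0.le (pow_le_one₀ hρ0.le hρ1.le)
  refine ⟨by linarith, by linarith, by ring, (ha ⟨hpos, hle⟩).1.trans_eq ?_⟩
  congr 1
  ring

theorem exists_le_mul_setIntegral_of_interpolation {E : Set ℝ} (hE : MeasurableSet E)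
    (hE0 : volume E ≠ 0) {T : ℝ} (hET : E ⊆ Set.Ioo 0 T) {κ δ Λ c D k : ℝ} (hκ0 : 0 < κ)
    (hκ1 : κ ≤ 1) (hδ0 : 0 < δ) (hδ1 : δ ≤ 1) (hΛ : 1 < Λ) (hc : 1 ≤ c) (hD : 0 ≤ D)
    (hk : 0 < k) :
    ∃ τ ∈ Set.Ioc 0 T, ∃ C > 0, ∀ F g : ℝ → ℝ,
      InterpolationEstimate κ δ Λ (fun L => c * Real.exp (D / L ^ k) / L) F g →
        (∀ t, 0 ≤ F t) → (∀ t, 0 ≤ g t) → (∃ G, ∀ t ∈ Set.Ioc 0 T, F t ≤ G) → IntegrableOn g E →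
          F τ ≤ C * ∫ t in E, g t := by
  obtain ⟨ρ, hρ0, hρ1, hρk⟩ : ∃ ρ : ℝ, 0 < ρ ∧ ρ < 1 ∧ ρ ^ k = 1 / 2 :=
    ⟨(1 / 2) ^ k⁻¹, by positivity, Real.rpow_lt_one (by norm_num) (by norm_num) (by positivity),
      Real.rpow_inv_rpow (by norm_num) hk.ne'⟩
  obtain ⟨l, ℓ, τ, hl0, hℓ0, hℓδ, hτ⟩ := exists_geometric_times hE hE0 hET hκ0 hδ0 hρ0 hρ1
  choose hτl hτT hτs hdens using hτ
  have hτ0 : ∀ m, 0 < τ m := fun m => hl0.trans_le (hτl m)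
  have hL0 : ∀ m, 0 < ℓ * ρ ^ m := fun m => by positivity
  have hLδ : ∀ m, ℓ * ρ ^ m < δ := fun m =>
    (mul_le_of_le_one_right hℓ0.le (pow_le_one₀ hρ0.le hρ1.le)).trans_lt hℓδ
  have hcost : ∀ m, 1 ≤ c * Real.exp (D / (ℓ * ρ ^ m) ^ k) / (ℓ * ρ ^ m) := fun m => by
    have hexp : 1 ≤ Real.exp (D / (ℓ * ρ ^ m) ^ k) := Real.one_le_exp (by positivity)
    rw [one_le_div (hL0 m)]
    exact (hLδ m).le.trans (hδ1.trans (one_le_mul_of_one_le_of_one_le hc hexp))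
  obtain ⟨N, hN, hgrowth⟩ := exists_exp_div_rpow_le_pow (c := c) hΛ hD hℓ0 hρ0 hρ1 hρk
  obtain ⟨w, n, hw0, hwlim, hw⟩ := exists_telescoping_weights hΛ hcost hN hgrowth
  refine ⟨τ 0, ⟨hτ0 0, hτT 0⟩, (w 0)⁻¹, inv_pos.2 (hw0 0), fun F g hFg hF hg0 ⟨G, hG⟩ hg => ?_⟩
  rw [← div_eq_inv_mul, le_div_iff₀ (hw0 0), mul_comm]
  refine le_setIntegral_of_telescoping (τ := τ) (a := fun m => w m * F (τ m)) hE hg hg0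
    (antitone_nat_of_succ_le fun m => by linarith [hτs m, hL0 m]) ?_ fun m => ?_
  · refine squeeze_zero (fun m => mul_nonneg (hw0 m).le (hF _)) (fun m => ?_)
      (by simpa using hwlim.mul_const G)
    exact mul_le_mul_of_nonneg_left (hG _ ⟨hτ0 m, hτT m⟩) (hw0 m).le
  · rw [← hτs m]
    exact hFg.mul_le_setIntegral_add hκ0 hκ1 hF hE hg hg0 (hτl _) (hτ0 _).le (hL0 m) (hLδ m)
      (by rw [hτs m]; exact hdens m) (hw0 m).le (hw m).1 (hw m).2

section Duality

variable {𝕜 : Type*} [RCLike 𝕜] {α : Type*} [MeasurableSpace α] {μ : Measure α}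
  [IsFiniteMeasure μ] {U : Type*} [NormedAddCommGroup U]

theorem integral_norm_le_sqrt_mul_eLpNorm {f : α → U} (hf : MemLp f 2 μ) :
    ∫ x, ‖f x‖ ∂μ ≤ √(μ.real Set.univ) * (eLpNorm f 2 μ).toReal := by
  have hle := eLpNorm_le_eLpNorm_mul_rpow_measure_univ (p := 1) (q := 2) one_le_two
    hf.aestronglyMeasurable
  rw [integral_norm_eq_lintegral_enorm hf.aestronglyMeasurable, ← eLpNorm_one_eq_lintegral_enorm]
  refine (ENNReal.toReal_mono (ENNReal.mul_ne_top hf.eLpNorm_ne_top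
    (ENNReal.rpow_ne_top_of_nonneg (by norm_num) (measure_ne_top μ _))) hle).trans_eq ?_
  rw [ENNReal.toReal_mul, ← ENNReal.toReal_rpow, mul_comm, Real.sqrt_eq_rpow, Measure.real]
  norm_num

variable [InnerProductSpace 𝕜 U]

theorem ae_norm_le_of_inner_le {w : Lp U 2 μ} {C : ℝ} (hC : 0 ≤ C)
    (h : ∀ f : Lp U 2 μ, ‖inner 𝕜 w f‖ ≤ C * ∫ x, ‖f x‖ ∂μ) : ∀ᵐ x ∂μ, ‖w x‖ ≤ C := by
  set A : Set α := {x | C < ‖w x‖}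
  have hA : MeasurableSet A :=
    measurableSet_lt measurable_const (Lp.stronglyMeasurable w).norm.measurable
  have hw1 : Integrable (fun x => ‖w x‖) μ := ((Lp.memLp w).integrable one_le_two).norm
  have hw2 : Integrable (fun x => ‖w x‖ ^ 2) μ := (Lp.memLp w).integrable_norm_pow two_ne_zero
  have hwA : MemLp (A.indicator w) 2 μ := (Lp.memLp w).indicator hA
  have hinner : inner 𝕜 w (hwA.toLp _) = ((∫ x in A, ‖w x‖ ^ 2 ∂μ : ℝ) : 𝕜) := by
    rw [L2.inner_def, ← integral_indicator hA, ← integral_ofReal]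
    refine integral_congr_ae (hwA.coeFn_toLp.mono fun x hx => ?_)
    by_cases hxA : x ∈ A <;> simp [hx, hxA, inner_self_eq_norm_sq_to_K]
  have hnorm : ∫ x, ‖hwA.toLp _ x‖ ∂μ = ∫ x in A, ‖w x‖ ∂μ := by
    rw [← integral_indicator hA]
    refine integral_congr_ae (hwA.coeFn_toLp.mono fun x hx => ?_)
    by_cases hxA : x ∈ A <;> simp [hx, hxA]
  have hle : ∫ x in A, (‖w x‖ ^ 2 - C * ‖w x‖) ∂μ ≤ 0 := by
    rw [integral_sub hw2.integrableOn (hw1.const_mul C).integrableOn, integral_const_mul,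
      sub_nonpos, ← hnorm]
    refine le_trans (le_abs_self _) ?_
    simpa only [hinner, RCLike.norm_ofReal] using h (hwA.toLp _)
  have hpos : ∀ x ∈ A, 0 < ‖w x‖ ^ 2 - C * ‖w x‖ := fun x (hx : C < ‖w x‖) => by
    rw [sub_pos, sq]
    exact mul_lt_mul_of_pos_right hx (hC.trans_lt hx)
  have hA0 : μ A = 0 := by
    by_contra hne
    refine hle.not_gt ((setIntegral_pos_iff_support_of_nonneg_ae
      ((ae_restrict_mem hA).mono fun x hx => (hpos x hx).le)
      (hw2.sub (hw1.const_mul C)).integrableOn).2 ?_)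
    exact (pos_iff_ne_zero.2 hne).trans_le (measure_mono fun x hx => ⟨(hpos x hx).ne', hx⟩)
  rw [ae_iff]
  simpa only [not_le] using hA0

theorem exists_dual_of_norm_le_integral {V : Type*} [AddCommGroup V] [Module 𝕜 V]
    (Φ : V →ₗ[𝕜] Lp U 2 μ) (l : V →ₗ[𝕜] 𝕜) {C : ℝ} (hC : 0 ≤ C)
    (h : ∀ v, ‖l v‖ ≤ C * ∫ x, ‖Φ v x‖ ∂μ) :
    ∃ G : Lp U 2 μ →L[𝕜] 𝕜, (∀ f, ‖G f‖ ≤ C * ∫ x, ‖f x‖ ∂μ) ∧ ∀ v, G (Φ v) = l v := by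
  let j : Lp U 2 μ →ₗ[𝕜] Lp U 1 μ :=
    { toFun := fun f => ⟨f.1, Lp.antitone one_le_two f.2⟩
      map_add' := fun _ _ => rfl
      map_smul' := fun _ _ => rfl }
  have hj : ∀ f, ‖j f‖ = ∫ x, ‖f x‖ ∂μ := fun f => L1.norm_eq_integral_norm (j f)
  obtain ⟨g, hg, hgl⟩ := exists_dual_of_norm_le (j.comp Φ) l hC fun v => by
    rw [LinearMap.comp_apply, hj]
    exact h v
  have hgj : ∀ f, ‖g (j f)‖ ≤ C * ∫ x, ‖f x‖ ∂μ := fun f => by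
    rw [← hj]
    exact g.le_of_opNorm_le hg _
  refine ⟨(g.toLinearMap.comp j).mkContinuous (C * √(μ.real Set.univ)) fun f => ?_, hgj, hgl⟩
  rw [mul_assoc]
  exact (hgj f).trans
    (mul_le_mul_of_nonneg_left (integral_norm_le_sqrt_mul_eLpNorm (Lp.memLp f)) hC)

variable [CompleteSpace U]

theorem exists_bounded_representation {V : Type*} [AddCommGroup V] [Module 𝕜 V]
    (Φ : V →ₗ[𝕜] Lp U 2 μ) (l : V →ₗ[𝕜] 𝕜) {C : ℝ} (hC : 0 ≤ C)
    (h : ∀ v, ‖l v‖ ≤ C * ∫ x, ‖Φ v x‖ ∂μ) :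
    ∃ w : α → U, StronglyMeasurable w ∧ (∀ x, ‖w x‖ ≤ C) ∧
      ∀ v, l v = ∫ x, inner 𝕜 (w x) (Φ v x) ∂μ := by
  obtain ⟨G, hG, hGl⟩ := exists_dual_of_norm_le_integral Φ l hC h
  set w : Lp U 2 μ := (InnerProductSpace.toDual 𝕜 (Lp U 2 μ)).symm G
  have hwG : ∀ f, inner 𝕜 w f = G f := fun f => InnerProductSpace.toDual_symm_apply
  have hwC : ∀ᵐ x ∂μ, ‖w x‖ ≤ C :=
    ae_norm_le_of_inner_le (𝕜 := 𝕜) hC fun f => (hwG f).symm ▸ hG f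
  set A : Set α := {x | ‖w x‖ ≤ C}
  have hA : MeasurableSet A :=
    measurableSet_le (Lp.stronglyMeasurable w).norm.measurable measurable_const
  refine ⟨A.indicator w, (Lp.stronglyMeasurable w).indicator hA, fun x => ?_, fun v => ?_⟩
  · rw [norm_indicator_eq_indicator_norm]
    exact Set.indicator_apply_le' (fun hx => hx) fun _ => hC
  · rw [← hGl, ← hwG, L2.inner_def]
    refine integral_congr_ae (hwC.mono fun x (hx : x ∈ A) => ?_)
    simp only [Set.indicator_of_mem hx]

end Duality

section AntidualIntegral

variable {𝕜 D : Type*} [RCLike 𝕜] [NormedAddCommGroup D] [NormedSpace 𝕜 D] {a b C : ℝ}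
  {U : Type*} [NormedAddCommGroup U] [NormedSpace 𝕜 U] {A : ℝ → D →L[𝕜] D}

theorem continuous_antidual_comp :
    Continuous fun p : (D →L⋆[𝕜] 𝕜) × (D →L[𝕜] D) => p.1.comp p.2 := by
  refine continuous_iff_continuousAt.2 fun p => tendsto_iff_norm_sub_tendsto_zero.2 ?_
  have hlim : Continuous fun q : (D →L⋆[𝕜] 𝕜) × (D →L[𝕜] D) =>
      ‖q.1 - p.1‖ * ‖q.2‖ + ‖p.1‖ * ‖q.2 - p.2‖ := by fun_prop
  refine squeeze_zero (fun _ => norm_nonneg _) (fun q => ?_) (hlim.tendsto' p 0 (by simp))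
  have hsub : q.1.comp q.2 - p.1.comp p.2 = (q.1 - p.1).comp q.2 + p.1.comp (q.2 - p.2) := by
    ext x
    simp
  rw [hsub]
  exact (norm_add_le _ _).trans (add_le_add (ContinuousLinearMap.opNorm_comp_le _ _)
    (ContinuousLinearMap.opNorm_comp_le _ _))

theorem intervalIntegrable_control_comp (B : U →L[𝕜] D →L⋆[𝕜] 𝕜) {f : ℝ → U} (hab : a ≤ b)
    (hf : IntervalIntegrable f volume a b) (hA : ContinuousOn A (Set.Ioo a b))
    (hC : ∀ t ∈ Set.Ioc a b, ‖A t‖ ≤ C) :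
    IntervalIntegrable (fun t => (B (f t)).comp (A t)) volume a b := by
  rw [intervalIntegrable_iff_integrableOn_Ioc_of_le hab] at hf ⊢
  have hBf : IntegrableOn (fun t => B (f t)) (Set.Ioc a b) := B.integrable_comp hf
  have hA' : AEStronglyMeasurable A (volume.restrict (Set.Ioc a b)) := by
    rw [← Measure.restrict_congr_set Ioo_ae_eq_Ioc]
    exact hA.aestronglyMeasurable measurableSet_Ioo
  refine Integrable.mono' (hBf.norm.mul_const C)
    (continuous_antidual_comp.comp_aestronglyMeasurable (hBf.aestronglyMeasurable.prodMk hA')) ?_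
  filter_upwards [ae_restrict_mem measurableSet_Ioc] with t ht
  exact (ContinuousLinearMap.opNorm_comp_le _ _).trans
    (mul_le_mul_of_nonneg_left (hC t ht) (norm_nonneg _))

theorem intervalIntegrable_control_comp_apply (B : U →L[𝕜] D →L⋆[𝕜] 𝕜) {f : ℝ → U} (hab : a ≤ b)
    (hf : IntervalIntegrable f volume a b) (hA : ContinuousOn A (Set.Ioo a b))
    (hC : ∀ t ∈ Set.Ioc a b, ‖A t‖ ≤ C) (φ : D) :
    IntervalIntegrable (fun t => B (f t) (A t φ)) volume a b := by
  have hint := intervalIntegrable_control_comp B hab hf hA hC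
  rw [intervalIntegrable_iff] at hint ⊢
  exact (ContinuousLinearMap.apply' 𝕜 (starRingEnd 𝕜) φ).integrable_comp hint

theorem intervalIntegral_control_comp_apply (B : U →L[𝕜] D →L⋆[𝕜] 𝕜) {f : ℝ → U} (hab : a ≤ b)
    (hf : IntervalIntegrable f volume a b) (hA : ContinuousOn A (Set.Ioo a b))
    (hC : ∀ t ∈ Set.Ioc a b, ‖A t‖ ≤ C) (φ : D) :
    (∫ t in a..b, (B (f t)).comp (A t)) φ = ∫ t in a..b, B (f t) (A t φ) :=
  ((ContinuousLinearMap.apply' 𝕜 (starRingEnd 𝕜) φ).intervalIntegral_comp_comm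
    (intervalIntegrable_control_comp B hab hf hA hC)).symm

end AntidualIntegral

theorem tendsto_coe_nhdsGT_zero : Tendsto (fun h : ℝ≥0 => (h : ℝ)) (𝓝[>] 0) (𝓝[≠] 0) := by
  refine tendsto_nhdsWithin_iff.2 ⟨?_, ?_⟩
  · exact (NNReal.continuous_coe.tendsto' 0 0 NNReal.coe_zero).mono_left nhdsWithin_le_nhds
  · filter_upwards [self_mem_nhdsWithin] with h hh
    exact NNReal.coe_ne_zero.2 (ne_of_gt hh)

theorem exists_re_eq_re_inner {𝕜 X Y : Type*} [RCLike 𝕜] [NormedAddCommGroup X]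
    [InnerProductSpace 𝕜 X] [NormedAddCommGroup Y] [NormedSpace ℂ Y] {ι : X →+ Y}
    (hι : ∀ x, ‖ι x‖ = ‖x‖) (hsmul : ∀ (r : ℝ) (x : X), ι ((r : 𝕜) • x) = (r : ℂ) • ι x) (ψ : X) :
    ∃ F : Y →L[ℂ] ℂ, ‖F‖ ≤ ‖ψ‖ ∧ ∀ x, (F (ι x)).re = RCLike.re (inner 𝕜 ψ x) := by
  let _ : NormedSpace ℝ X := NormedSpace.restrictScalars ℝ 𝕜 X
  have hreal : ∀ (a : ℝ) (x : X), a • x = (a : 𝕜) • x := fun _ _ => rfl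
  let ιℝ : X →ₗ[ℝ] Y :=
    { ι with map_smul' := fun a x => (hsmul a x).trans (Complex.coe_smul a (ι x)) }
  let l : X →ₗ[ℝ] ℝ :=
    { toFun := fun x => RCLike.re (inner 𝕜 ψ x)
      map_add' := fun x y => by rw [inner_add_right, map_add]
      map_smul' := fun a x => by
        rw [hreal, inner_smul_right, RCLike.re_ofReal_mul, RingHom.id_apply, smul_eq_mul] }
  obtain ⟨g, hg, hgl⟩ := exists_dual_of_norm_le ιℝ l (norm_nonneg ψ) fun x => by
    change |RCLike.re (inner 𝕜 ψ x)| ≤ ‖ψ‖ * ‖ι x‖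
    rw [hι]
    exact (RCLike.abs_re_le_norm _).trans (norm_inner_le_norm _ _)
  refine ⟨StrongDual.extendRCLike (𝕜 := ℂ) g, (StrongDual.norm_extendRCLike g).trans_le hg,
    fun x => ?_⟩
  have hre : RCLike.re (StrongDual.extendRCLike (𝕜 := ℂ) g (ι x)) = g (ι x) := by simp
  exact hre.trans (hgl x)

namespace C0Semigroup

variable {𝕜 : Type*} [RCLike 𝕜] {X : Type*} [NormedAddCommGroup X] [InnerProductSpace 𝕜 X]
  {S : C0Semigroup 𝕜 X}

theorem exists_norm_op_le [CompleteSpace X] (S : C0Semigroup 𝕜 X) (T : ℝ≥0) :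
    ∃ C : ℝ, 0 < C ∧ ∀ t ≤ T, ‖S.op t‖ ≤ C := by
  obtain ⟨C, hC⟩ := banach_steinhaus (g := fun t : Set.Icc (0 : ℝ≥0) T => S.op t) fun x => by
    obtain ⟨C, hC⟩ := (isCompact_Icc.image (S.continuous_orbit x)).isBounded.exists_norm_le
    exact ⟨C, fun t => hC _ ⟨t, t.2, rfl⟩⟩
  exact ⟨max C 1, by positivity, fun t ht => (hC ⟨t, zero_le, ht⟩).trans (le_max_left _ _)⟩

theorem IsAnalytic.continuousOn_op (hS : S.IsAnalytic) : ContinuousOn S.op (Set.Ioi 0) := by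
  obtain ⟨Y, _, _, _, ι, θ, T, hι, -, -, hθ, hθ2, hT, hTS⟩ := hS
  intro s hs
  have hT_cont : ContinuousAt T ((s : ℝ) : ℂ) := hT.holomorphic.continuousOn.continuousAt
    ((isOpen_openSector (by linarith [Real.pi_pos])).mem_nhds (ofReal_mem_openSector hθ hs))
  have hlim : ContinuousAt (fun t : ℝ≥0 => T ((t : ℝ) : ℂ)) s :=
    ContinuousAt.comp (f := fun t : ℝ≥0 => ((t : ℝ) : ℂ)) hT_cont (by fun_prop)
  refine ContinuousAt.continuousWithinAt ?_
  rw [ContinuousAt, tendsto_iff_norm_sub_tendsto_zero] at hlim ⊢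
  refine squeeze_zero (fun _ => norm_nonneg _) (fun t => ?_) hlim
  refine ContinuousLinearMap.opNorm_le_bound _ (norm_nonneg _) fun x => ?_
  rw [← hι, ← hι x, sub_apply, map_sub, ← hTS, ← hTS, ← sub_apply]
  exact ContinuousLinearMap.le_opNorm _ _

theorem IsAnalytic.exists_hasGeneratorValue [CompleteSpace X] (hS : S.IsAnalytic) {s : ℝ≥0}
    (hs : 0 < s) (x : X) : ∃ y, S.HasGeneratorValue (S.op s x) y := by
  obtain ⟨Y, _, _, _, ι, θ, T, hι, hsmul, -, hθ, hθ2, hT, hTS⟩ := hS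
  have hderiv : HasDerivAt T (deriv T ((s : ℝ) : ℂ)) ((s : ℝ) : ℂ) :=
    (hT.holomorphic.differentiableAt ((isOpen_openSector (by linarith [Real.pi_pos])).mem_nhds
      (ofReal_mem_openSector hθ hs))).hasDerivAt
  have hcast : Tendsto ((↑) : ℝ → ℂ) (𝓝[≠] 0) (𝓝[≠] 0) := by
    simpa using (Complex.continuous_ofReal.continuousWithinAt
      (x := 0) (s := {0}ᶜ)).tendsto_nhdsWithin (t := {0}ᶜ) fun _ => Complex.ofReal_ne_zero.2
  have hslope := (hasDerivAt_iff_tendsto_slope_zero.1 hderiv).comp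
    (hcast.comp tendsto_coe_nhdsGT_zero)
  have hlim : Tendsto (fun h : ℝ≥0 => ι ((((h : ℝ) : 𝕜))⁻¹ • (S.op h (S.op s x) - S.op s x)))
      (𝓝[>] 0) (𝓝 (deriv T ((s : ℝ) : ℂ) (ι x))) := by
    refine (((ContinuousLinearMap.apply ℂ Y (ι x)).continuous.tendsto _).comp hslope).congr
      fun h => ?_
    rw [← RCLike.ofReal_inv, hsmul, map_sub, ← ContinuousLinearMap.comp_apply, ← S.op_add, ← hTS,
      ← hTS]
    simp [add_comm]
  have hiso : Isometry ι := AddMonoidHomClass.isometry_of_norm ι hι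
  obtain ⟨y, hy⟩ := hiso.isClosedEmbedding.isClosed_range.mem_of_tendsto hlim
    (Eventually.of_forall fun h => ⟨_, rfl⟩)
  exact ⟨y, hiso.isEmbedding.tendsto_nhds_iff.2 (hy.symm ▸ hlim)⟩

theorem IsAnalytic.hasHolomorphicExtension_inner (hS : S.IsAnalytic) :
    ∃ r δ C : ℝ, 0 < r ∧ r < 1 ∧ 0 < δ ∧ 0 < C ∧ ∀ (ψ x : X) (s : ℝ), 0 < s → s < δ →
      HasHolomorphicExtension (fun t => RCLike.re (inner 𝕜 ψ (S.op t.toNNReal x))) s (r * s)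
        (C * ‖ψ‖ * ‖x‖) := by
  obtain ⟨Y, _, _, _, ι, θ, T, hι, hsmul, -, hθ, -, hT, hTS⟩ := hS
  obtain ⟨r, hr0, hr1, hball⟩ := exists_ball_subset_openSector hθ
  obtain ⟨δ, C, hδ, hC, hTC⟩ := hT.exists_norm_le
  refine ⟨r, δ / 2, C, hr0, hr1, by positivity, hC, fun ψ x s hs hsδ => ?_⟩
  obtain ⟨F, hF, hFre⟩ := exists_re_eq_re_inner hι hsmul ψ
  refine ⟨fun z => F (T z (ι x)), ?_, fun z hz => ?_, fun t ht => ?_⟩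
  · exact F.differentiable.comp_differentiableOn
      ((hT.holomorphic.mono (hball s hs)).clm_apply (differentiableOn_const _))
  · have hzδ : ‖z‖ < δ := by
      have hzs : ‖z‖ ≤ ‖z - s‖ + ‖(s : ℂ)‖ := by simpa using norm_add_le (z - s) (s : ℂ)
      rw [Complex.norm_real, Real.norm_of_nonneg hs.le] at hzs
      nlinarith [mem_ball_iff_norm.1 hz]
    calc ‖F (T z (ι x))‖ ≤ ‖ψ‖ * (C * ‖ι x‖) :=
          F.le_of_opNorm_le_of_le hF ((T z).le_of_opNorm_le (hTC z (hball s hs hz) hzδ) _)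
      _ = C * ‖ψ‖ * ‖x‖ := by rw [hι]; ring
  · have ht0 : 0 ≤ t := by nlinarith [(abs_lt.1 (ofReal_mem_ball_ofReal.1 ht)).1]
    simp only [← hFre, ← hTS, Real.coe_toNNReal t ht0]

variable [CompleteSpace X]

/-- The inclusion `D(A*) → X`. In the encoding of `D(A*)` as the graph of `A*`, it is the first
projection. -/
noncomputable def incl (S : C0Semigroup 𝕜 X) : S.adjointDomain →L[𝕜] X :=
  (WithLp.fstL 2 𝕜 X X).comp S.adjointDomain.subtypeL

/-- The adjoint `A* : D(A*) → X` of the generator, which is bounded for the graph norm. In the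
encoding of `D(A*)` as the graph of `A*`, it is the second projection. -/
noncomputable def adjointGenerator (S : C0Semigroup 𝕜 X) : S.adjointDomain →L[𝕜] X :=
  (WithLp.sndL 2 𝕜 X X).comp S.adjointDomain.subtypeL

theorem norm_adjoint_op (t : ℝ≥0) : ‖(S.op t).adjoint‖ = ‖S.op t‖ :=
  LinearIsometryEquiv.norm_map ContinuousLinearMap.adjoint (S.op t)

theorem incl_adjointOp (t : ℝ≥0) (φ : S.adjointDomain) :
    S.incl (S.adjointOp t φ) = (S.op t).adjoint (S.incl φ) := rfl

theorem adjointGenerator_adjointOp (t : ℝ≥0) (φ : S.adjointDomain) :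
    S.adjointGenerator (S.adjointOp t φ) = (S.op t).adjoint (S.adjointGenerator φ) := rfl

theorem adjointOp_add (s t : ℝ≥0) (φ : S.adjointDomain) :
    S.adjointOp (s + t) φ = S.adjointOp s (S.adjointOp t φ) := by
  have hadd : (S.op (s + t)).adjoint = (S.op s).adjoint.comp (S.op t).adjoint := by
    rw [add_comm, S.op_add, ContinuousLinearMap.adjoint_comp]
  refine Subtype.ext (WithLp.ofLp_injective 2 (Prod.ext ?_ ?_))
  · exact congr($hadd (S.incl φ))
  · exact congr($hadd (S.adjointGenerator φ))

theorem norm_le_mul_norm_of_incl_le {φ ψ : S.adjointDomain} {C : ℝ} (hC : 0 ≤ C)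
    (hincl : ‖S.incl φ‖ ≤ C * ‖S.incl ψ‖)
    (hgen : ‖S.adjointGenerator φ‖ ≤ C * ‖S.adjointGenerator ψ‖) : ‖φ‖ ≤ C * ‖ψ‖ := by
  rw [← Submodule.norm_coe, ← Submodule.norm_coe, WithLp.prod_norm_eq_of_L2,
    WithLp.prod_norm_eq_of_L2, ← Real.sqrt_sq hC, ← Real.sqrt_mul (sq_nonneg C), mul_add,
    ← mul_pow, ← mul_pow]
  gcongr
  exacts [hincl, hgen]

theorem norm_adjointOp_le (t : ℝ≥0) : ‖S.adjointOp t‖ ≤ ‖S.op t‖ :=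
  ContinuousLinearMap.opNorm_le_bound _ (norm_nonneg _) fun _ => by
    rw [← norm_adjoint_op]
    exact norm_le_mul_norm_of_incl_le (norm_nonneg _) ((S.op t).adjoint.le_opNorm _)
      ((S.op t).adjoint.le_opNorm _)

theorem norm_adjointOp_sub_le (s t : ℝ≥0) :
    ‖S.adjointOp t - S.adjointOp s‖ ≤ ‖S.op t - S.op s‖ :=
  ContinuousLinearMap.opNorm_le_bound _ (norm_nonneg _) fun _ => by
    rw [← LinearIsometryEquiv.norm_map ContinuousLinearMap.adjoint (S.op t - S.op s), map_sub]
    exact norm_le_mul_norm_of_incl_le (norm_nonneg _)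
      (((S.op t).adjoint - (S.op s).adjoint).le_opNorm _)
      (((S.op t).adjoint - (S.op s).adjoint).le_opNorm _)

theorem IsAnalytic.continuousOn_adjointOp (hS : S.IsAnalytic) :
    ContinuousOn S.adjointOp (Set.Ioi 0) := by
  intro s hs
  have hlim := hS.continuousOn_op s hs
  rw [ContinuousWithinAt, tendsto_iff_norm_sub_tendsto_zero] at hlim
  refine (tendsto_iff_norm_sub_tendsto_zero (E := S.adjointDomain →L[𝕜] S.adjointDomain)).2 ?_
  exact squeeze_zero (fun _ => ContinuousLinearMap.opNorm_nonneg _)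
    (norm_adjointOp_sub_le s) hlim

theorem exists_inner_incl_add_inner_adjointGenerator (ξ : S.Xneg) :
    ∃ a b : X, ‖a‖ ≤ ‖ξ‖ ∧ ‖b‖ ≤ ‖ξ‖ ∧
      ∀ φ, ξ φ = inner 𝕜 (S.incl φ) a + inner 𝕜 (S.adjointGenerator φ) b := by
  obtain ⟨w, hw, hwξ⟩ := exists_inner_eq_of_norm_le S.adjointDomain.subtype
    (ξ : S.adjointDomain →ₗ⋆[𝕜] 𝕜) (norm_nonneg ξ) fun φ => ξ.le_opNorm φ
  exact ⟨w.fst, w.snd, (WithLp.norm_fst_le _ _).trans hw, (WithLp.norm_snd_le _ _).trans hw,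
    fun φ => (hwξ φ).symm.trans (WithLp.prod_inner_apply _ _)⟩

theorem IsAnalytic.re_inner_adjointGenerator_eq_deriv (hS : S.IsAnalytic) (φ : S.adjointDomain)
    (b : X) {s : ℝ} (hs : 0 < s)
    (hd : DifferentiableAt ℝ
      (fun t : ℝ => RCLike.re (inner 𝕜 (S.incl φ) (S.op t.toNNReal b))) s) :
    RCLike.re (inner 𝕜 (S.adjointGenerator φ) (S.op s.toNNReal b)) =
      deriv (fun t : ℝ => RCLike.re (inner 𝕜 (S.incl φ) (S.op t.toNNReal b))) s := by
  obtain ⟨y, hy⟩ := hS.exists_hasGeneratorValue (Real.toNNReal_pos.2 hs) b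
  obtain ⟨hmem, hgen⟩ := S.generator_eq hy
  have hadj : inner 𝕜 (S.incl φ) y = inner 𝕜 (S.adjointGenerator φ) (S.op s.toNNReal b) :=
    hgen ▸ (S.mem_adjointDomain_iff _).1 φ.2 ⟨_, hmem⟩
  have hcont : Continuous fun x : X => RCLike.re (inner 𝕜 (S.incl φ) x) := by fun_prop
  rw [← hadj]
  refine tendsto_nhds_unique (((hcont.tendsto _).comp hy).congr fun h => ?_)
    ((hasDerivAt_iff_tendsto_slope_zero.1 hd.hasDerivAt).comp tendsto_coe_nhdsGT_zero)
  simp only [Function.comp_apply]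
  rw [← RCLike.ofReal_inv, inner_smul_right, RCLike.re_ofReal_mul, inner_sub_right, map_sub,
    ← ContinuousLinearMap.comp_apply, ← S.op_add, Real.toNNReal_add hs.le (NNReal.coe_nonneg h),
    Real.toNNReal_coe, add_comm h, smul_eq_mul]

theorem IsAnalytic.hasHolomorphicExtension_antidual (hS : S.IsAnalytic) :
    ∃ r δ C : ℝ, 0 < r ∧ r < 1 ∧ 0 < δ ∧ 0 < C ∧ ∀ (ξ : S.Xneg) (φ : S.adjointDomain) (s : ℝ),
      0 < s → s < δ → HasHolomorphicExtension
        (fun t => RCLike.re (ξ (S.adjointOp t.toNNReal φ))) s (r * s)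
        (C / s * ‖ξ‖ * ‖S.incl φ‖) := by
  obtain ⟨r, δ, C, hr0, hr1, hδ, hC, hext⟩ := hS.hasHolomorphicExtension_inner
  refine ⟨r / 2, min δ 1, C * (1 + 2 / r), by positivity, by linarith, by positivity,
    by positivity, fun ξ φ s hs hsδ => ?_⟩
  obtain ⟨a, b, ha, hb, hab⟩ := exists_inner_incl_add_inner_adjointGenerator ξ
  have hs1 : s ≤ 1 := (hsδ.trans_le (min_le_right _ _)).le
  have hextA := hext (S.incl φ) a s hs (hsδ.trans_le (min_le_left _ _))
  have hextB := hext (S.incl φ) b s hs (hsδ.trans_le (min_le_left _ _))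
  have hsum := (hextA.mono (R' := r * s / 2) (by linarith [mul_pos hr0 hs]) le_rfl).add
    (hextB.deriv (by positivity))
  refine ((hsum.congr fun t ht => ?_).mono (by linarith) ?_)
  · have ht0 : 0 < t := by nlinarith [(abs_lt.1 ht).1]
    have hts : |t - s| < r * s := by linarith [mul_pos hr0 hs]
    rw [← hS.re_inner_adjointGenerator_eq_deriv φ b ht0 (hextB.differentiableAt hts), hab, map_add,
      incl_adjointOp, adjointGenerator_adjointOp, ContinuousLinearMap.adjoint_inner_left,
      ContinuousLinearMap.adjoint_inner_left]
  · have hCs : C ≤ C / s := by rw [le_div_iff₀ hs]; nlinarith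
    calc C * ‖S.incl φ‖ * ‖a‖ + C * ‖S.incl φ‖ * ‖b‖ / (r * s / 2)
        ≤ C / s * ‖S.incl φ‖ * ‖ξ‖ + C * ‖S.incl φ‖ * ‖ξ‖ / (r * s / 2) := by gcongr
      _ = C * (1 + 2 / r) / s * ‖ξ‖ * ‖S.incl φ‖ := by field_simp

end C0Semigroup

theorem norm_le_of_re_inner_le {𝕜 U : Type*} [RCLike 𝕜] [NormedAddCommGroup U]
    [InnerProductSpace 𝕜 U] {v : U} {G : ℝ}
    (h : ∀ u : U, ‖u‖ ≤ 1 → RCLike.re (inner 𝕜 v u) ≤ G) : ‖v‖ ≤ G := by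
  rcases eq_or_ne v 0 with rfl | hv
  · simpa using h 0 (by simp)
  have hv' : 0 < ‖v‖ := norm_pos_iff.2 hv
  have hu := h (((‖v‖⁻¹ : ℝ) : 𝕜) • v) <| by
    rw [norm_smul, RCLike.norm_ofReal, abs_of_pos (by positivity), inv_mul_cancel₀ hv'.ne']
  rw [inner_smul_right, RCLike.re_ofReal_mul, inner_self_eq_norm_sq] at hu
  calc ‖v‖ = ‖v‖⁻¹ * ‖v‖ ^ 2 := by field_simp
    _ ≤ G := hu

namespace C0Semigroup

variable {𝕜 : Type*} [RCLike 𝕜] {X : Type*} [NormedAddCommGroup X] [InnerProductSpace 𝕜 X]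
  [CompleteSpace X] {S : C0Semigroup 𝕜 X} {U : Type*} [NormedAddCommGroup U]
  [InnerProductSpace 𝕜 U] [CompleteSpace U]

/-- The output `t ↦ B* S(t)* φ` of the dual system, for `φ ∈ D(A*)`. Time is a real number, and
the semigroup is evaluated at `max t 0`. -/
noncomputable def output (B : U →L[𝕜] S.Xneg) (φ : S.adjointDomain) (t : ℝ) : U :=
  S.adjointControl B (S.adjointOp t.toNNReal φ)

theorem inner_output (B : U →L[𝕜] S.Xneg) (φ : S.adjointDomain) (t : ℝ) (u : U) :
    inner 𝕜 (output B φ t) u = B u (S.adjointOp t.toNNReal φ) :=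
  S.inner_adjointControl B _ u

theorem norm_adjointControl_le (B : U →L[𝕜] S.Xneg) (φ : S.adjointDomain) :
    ‖S.adjointControl B φ‖ ≤ ‖B.flip‖ * ‖φ‖ := by
  rw [adjointControl, LinearIsometryEquiv.norm_map]
  exact B.flip.le_opNorm φ

theorem norm_control_le (B : U →L[𝕜] S.Xneg) (u : U) : ‖B u‖ ≤ ‖B.flip‖ * ‖u‖ :=
  ContinuousLinearMap.opNorm_le_bound _ (by positivity) fun φ => by
    rw [← inner_adjointControl, mul_right_comm]
    exact (norm_inner_le_norm _ _).trans (by gcongr; exact norm_adjointControl_le B φ)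

theorem continuous_adjointControl (B : U →L[𝕜] S.Xneg) : Continuous (S.adjointControl B) :=
  (LinearIsometryEquiv.continuous _).comp B.flip.continuous

theorem output_add (B : U →L[𝕜] S.Xneg) (φ ψ : S.adjointDomain) (t : ℝ) :
    output B (φ + ψ) t = output B φ t + output B ψ t :=
  ext_inner_right 𝕜 fun u => by simp only [inner_output, inner_add_left, map_add]

theorem output_smul (B : U →L[𝕜] S.Xneg) (c : 𝕜) (φ : S.adjointDomain) (t : ℝ) :
    output B (c • φ) t = c • output B φ t :=
  ext_inner_right 𝕜 fun u => by
    simp only [inner_output, inner_smul_left, map_smul, map_smulₛₗ, smul_eq_mul]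

theorem output_add_time (B : U →L[𝕜] S.Xneg) (φ : S.adjointDomain) {s t : ℝ} (hs : 0 ≤ s)
    (ht : 0 ≤ t) : output B φ (s + t) = output B (S.adjointOp t.toNNReal φ) s := by
  rw [output, output, Real.toNNReal_add hs ht, adjointOp_add]

theorem IsAnalytic.continuousOn_output (hS : S.IsAnalytic) (B : U →L[𝕜] S.Xneg)
    (φ : S.adjointDomain) : ContinuousOn (output B φ) (Set.Ioi 0) := by
  have hop : ContinuousOn (fun t : ℝ => S.adjointOp t.toNNReal) (Set.Ioi 0) :=
    hS.continuousOn_adjointOp.comp continuous_real_toNNReal.continuousOn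
      fun t ht => Real.toNNReal_pos.2 ht
  exact (continuous_adjointControl B).comp_continuousOn (hop.clm_apply continuousOn_const)

theorem exists_norm_output_le (B : U →L[𝕜] S.Xneg) (φ : S.adjointDomain) (T : ℝ≥0) :
    ∃ C : ℝ, ∀ t : ℝ, t ≤ T → ‖output B φ t‖ ≤ C := by
  obtain ⟨C, -, hC⟩ := S.exists_norm_op_le T
  refine ⟨‖B.flip‖ * (C * ‖φ‖), fun t ht => (norm_adjointControl_le B _).trans ?_⟩
  gcongr
  exact (S.adjointOp _).le_of_opNorm_le
    ((norm_adjointOp_le _).trans (hC _ (Real.toNNReal_le_iff_le_coe.2 ht))) φ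

theorem IsAnalytic.memLp_output (hS : S.IsAnalytic) (B : U →L[𝕜] S.Xneg) (φ : S.adjointDomain)
    {A : Set ℝ} (hA : MeasurableSet A) {T : ℝ≥0} (hAT : A ⊆ Set.Ioc 0 (T : ℝ)) (p : ENNReal) :
    MemLp (output B φ) p (volume.restrict A) := by
  obtain ⟨C, hC⟩ := exists_norm_output_le B φ T
  have : IsFiniteMeasure (volume.restrict A) :=
    isFiniteMeasure_restrict.2 (ne_top_of_le_ne_top (by simp) (measure_mono hAT))
  refine MemLp.of_bound ?_ C ?_
  · exact ((hS.continuousOn_output B φ).aestronglyMeasurable measurableSet_Ioi).mono_measure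
      (Measure.restrict_mono (fun t ht => (hAT ht).1) le_rfl)
  · filter_upwards [ae_restrict_mem hA] with t ht using hC t (hAT ht).2

theorem IsAnalytic.exists_norm_output_le_of_measure (hS : S.IsAnalytic) (B : U →L[𝕜] S.Xneg) :
    ∃ κ δ C : ℝ, 0 < κ ∧ κ < 1 ∧ 0 < δ ∧ 0 ≤ C ∧ ∀ (n : ℕ) (φ : S.adjointDomain) (s ε : ℝ),
      0 < s → s < δ → ∀ A ⊆ Set.Icc (s - κ * s) s, ENNReal.ofReal (κ * s / 4) ≤ volume A →
        (∀ x ∈ A, ‖output B φ x‖ ≤ ε) → ∀ y ∈ Set.Icc (s - κ * s) s,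
          ‖output B φ y‖ ≤ 48 ^ n * ε + C / s * ‖S.incl φ‖ * (((48 : ℝ) ^ n) ^ 2)⁻¹ := by
  obtain ⟨r, δ, C, hr0, hr1, hδ, hC, hext⟩ := hS.hasHolomorphicExtension_antidual
  refine ⟨(48 ^ 3)⁻¹ * (r / 2), δ, 4 * (C * ‖B.flip‖), by positivity, by linarith, hδ,
    by positivity, fun n φ s ε hs hsδ A hA hv hε y hy =>
      norm_le_of_re_inner_le (𝕜 := 𝕜) fun u hu => ?_⟩
  have houtput : (fun t => RCLike.re (B u (S.adjointOp t.toNNReal φ))) =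
      fun t => RCLike.re (inner 𝕜 (output B φ t) u) := by simp only [inner_output]
  have hextu := houtput ▸ hext (B u) φ s hs hsδ
  rw [show r * s = 2 * (r / 2 * s) by ring] at hextu
  rw [mul_assoc] at hA hv hy
  have hsmall : ∀ x ∈ A, |RCLike.re (inner 𝕜 (output B φ x) u)| ≤ ε := fun x hx =>
    (RCLike.abs_re_le_norm _).trans <| (norm_inner_le_norm _ _).trans <|
      (mul_le_of_le_one_right (norm_nonneg _) hu).trans (hε x hx)
  have hBu : ‖B u‖ ≤ ‖B.flip‖ :=
    (norm_control_le B u).trans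
      (mul_le_of_le_one_right (ContinuousLinearMap.opNorm_nonneg _) hu)
  calc RCLike.re (inner 𝕜 (output B φ y) u) ≤ |RCLike.re (inner 𝕜 (output B φ y) u)| :=
        le_abs_self _
    _ ≤ 48 ^ n * ε + 4 * (C / s * ‖B u‖ * ‖S.incl φ‖) * (48 * (48 ^ 3)⁻¹) ^ n :=
        hextu.abs_le_of_measure (by positivity) n (by positivity) (by norm_num) hA hv hsmall hy
    _ ≤ 48 ^ n * ε + 4 * (C / s * ‖B.flip‖ * ‖S.incl φ‖) * (48 * (48 ^ 3)⁻¹) ^ n := by gcongr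
    _ = 48 ^ n * ε + 4 * (C * ‖B.flip‖) / s * ‖S.incl φ‖ * (((48 : ℝ) ^ n) ^ 2)⁻¹ := by
        rw [show (48 * (48 ^ 3)⁻¹ : ℝ) = (48 ^ 2)⁻¹ by norm_num, inv_pow, pow_right_comm]
        ring

theorem IsObservable.norm_adjoint_op_le {B : U →L[𝕜] S.Xneg} {d k : ℝ}
    (hobs : S.IsObservable B d k) (hd : 0 ≤ d) (φ : S.adjointDomain) {a L G : ℝ} (ha : 0 ≤ a)
    (hL : 0 < L) (hL1 : L ≤ 1) (hG : ∀ t ∈ Set.Icc a (a + L), ‖output B φ t‖ ≤ G) :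
    ‖(S.op (a + L).toNNReal).adjoint (S.incl φ)‖ ≤ Real.exp (d / L ^ k) * G := by
  have hG0 : 0 ≤ G := (norm_nonneg _).trans (hG a ⟨le_rfl, by linarith⟩)
  have hint : ∫ t in (0 : ℝ)..L, ‖output B (S.adjointOp a.toNNReal φ) t‖ ^ 2 ≤ G ^ 2 := by
    have hbound : ∀ t ∈ Set.uIoc 0 L, ‖‖output B (S.adjointOp a.toNNReal φ) t‖ ^ 2‖ ≤ G ^ 2 := by
      intro t ht
      rw [Set.uIoc_of_le hL.le] at ht
      rw [Real.norm_of_nonneg (by positivity), ← output_add_time B φ ht.1.le ha]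
      gcongr
      exact hG _ ⟨by linarith [ht.1], by linarith [ht.2]⟩
    refine (le_abs_self _).trans <|
      (intervalIntegral.norm_integral_le_of_norm_le_const hbound).trans ?_
    rw [sub_zero, abs_of_pos hL]
    exact mul_le_of_le_one_right (by positivity) hL1
  have hsq := hobs (S.adjointOp a.toNNReal φ) L.toNNReal (Real.toNNReal_pos.2 hL)
    (Real.toNNReal_le_one.2 hL1)
  rw [Real.coe_toNNReal _ hL.le] at hsq
  have hop : (S.op L.toNNReal).adjoint (S.incl (S.adjointOp a.toNNReal φ)) =
      (S.op (a + L).toNNReal).adjoint (S.incl φ) := by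
    rw [← incl_adjointOp, ← adjointOp_add, ← Real.toNNReal_add hL.le ha, add_comm, incl_adjointOp]
  rw [← hop]
  refine le_of_sq_le_sq ?_ (by positivity)
  calc _ ≤ Real.exp (d / L ^ k) * G ^ 2 := hsq.trans (by gcongr; exact hint)
    _ ≤ Real.exp (d / L ^ k) * (Real.exp (d / L ^ k) * G ^ 2) :=
        le_mul_of_one_le_left (by positivity) (Real.one_le_exp (by positivity))
    _ = (Real.exp (d / L ^ k) * G) ^ 2 := by ring

theorem IsAnalytic.exists_norm_output_le_setIntegral (hS : S.IsAnalytic) (B : U →L[𝕜] S.Xneg) :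
    ∃ κ δ c : ℝ, 0 < κ ∧ κ < 1 ∧ 0 < δ ∧ 1 ≤ c ∧ ∀ (n : ℕ) (φ : S.adjointDomain) (t L : ℝ),
      0 ≤ t → 0 < L → L < δ → ∀ A, MeasurableSet A → A ⊆ Set.Icc (t + L - κ * L) (t + L) →
        ENNReal.ofReal (κ * L / 2) ≤ volume A → ∀ y ∈ Set.Icc (t + L - κ * L) (t + L),
          ‖output B φ y‖ ≤ c / L * (48 ^ n * (∫ x in A, ‖output B φ x‖) +
            (((48 : ℝ) ^ n) ^ 2)⁻¹ * ‖(S.op t.toNNReal).adjoint (S.incl φ)‖) := by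
  obtain ⟨κ, δ, C, hκ0, hκ1, hδ, -, hprop⟩ := hS.exists_norm_output_le_of_measure B
  refine ⟨κ, δ, max 1 (max (4 / κ) C), hκ0, hκ1, hδ, le_max_left _ _,
    fun n φ t L ht hL hLδ A hAm hA hv y hy => ?_⟩
  have hκL : κ * L < L := by nlinarith
  set I := ∫ x in A, ‖output B φ x‖ with hI
  have : 0 ≤ I := integral_nonneg fun _ => norm_nonneg _
  have hAT : A ⊆ Set.Ioc (0 : ℝ) ((t + L).toNNReal : ℝ) := fun x hx => by
    rw [Real.coe_toNNReal _ (by linarith)]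
    exact ⟨by linarith [(hA hx).1], (hA hx).2⟩
  -- Chebyshev: on at least half of `A` the output is at most twice its mean over `A`.
  have hcheb := ofReal_half_le_measure_le_average
    (memLp_one_iff_integrable.1 (hS.memLp_output B φ hAm hAT 1).norm)
    (fun x => norm_nonneg _) (m := κ * L / 2) (by positivity) hv
  rw [← hI] at hcheb
  have hshift : ∀ x, t + L - κ * L ≤ x →
      output B (S.adjointOp t.toNNReal φ) (x - t) = output B φ x := fun x hx => by
    rw [← output_add_time B φ (by linarith) ht, sub_add_cancel]
  rw [← hshift y hy.1]
  calc _ ≤ 48 ^ n * (2 / (κ * L / 2) * I) +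
        C / L * ‖(S.op t.toNNReal).adjoint (S.incl φ)‖ * (((48 : ℝ) ^ n) ^ 2)⁻¹ := by
        refine hprop n _ L _ hL hLδ ((fun x => x + t) ⁻¹' {x ∈ A | _}) (fun x hx => ?_)
          (by rw [measure_preimage_add_right]; convert hcheb using 2; ring) (fun x hx => ?_)
          (y - t) ⟨by linarith [hy.1], by linarith [hy.2]⟩
        · exact ⟨by linarith [(hA hx.1).1], by linarith [(hA hx.1).2]⟩
        · rw [← add_sub_cancel_right x t, hshift _ (hA hx.1).1]
          exact hx.2
    _ = 4 / κ / L * (48 ^ n * I) +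
          C / L * ((((48 : ℝ) ^ n) ^ 2)⁻¹ * ‖(S.op t.toNNReal).adjoint (S.incl φ)‖) := by
        field_simp
        ring
    _ ≤ max 1 (max (4 / κ) C) / L * (48 ^ n * I) + max 1 (max (4 / κ) C) / L *
          ((((48 : ℝ) ^ n) ^ 2)⁻¹ * ‖(S.op t.toNNReal).adjoint (S.incl φ)‖) := by
        gcongr
        exacts [(le_max_left _ _).trans (le_max_right _ _),
          (le_max_right _ _).trans (le_max_right _ _)]
    _ = _ := by ring

theorem IsAnalytic.exists_interpolationEstimate (hS : S.IsAnalytic) {B : U →L[𝕜] S.Xneg}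
    {d k : ℝ} (hd : 0 ≤ d) (hobs : S.IsObservable B d k) :
    ∃ κ δ c D : ℝ, 0 < κ ∧ κ ≤ 1 ∧ 0 < δ ∧ δ ≤ 1 ∧ 1 ≤ c ∧ 0 ≤ D ∧ ∀ φ : S.adjointDomain,
      InterpolationEstimate κ δ 48 (fun L => c * Real.exp (D / L ^ k) / L)
        (fun t => ‖(S.op t.toNNReal).adjoint (S.incl φ)‖) (fun t => ‖output B φ t‖) := by
  obtain ⟨κ, δ, c, hκ0, hκ1, hδ, hc, hbound⟩ := hS.exists_norm_output_le_setIntegral B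
  refine ⟨κ, min δ 1, c, d / κ ^ k, hκ0, hκ1.le, by positivity, min_le_right _ _, hc,
    by positivity, fun φ n t L ht hL hLδ A hAm hA hv => ?_⟩
  have hL1 : L < 1 := hLδ.trans_le (min_le_right _ _)
  have hκL : κ * L < L := by nlinarith
  have hobsL := hobs.norm_adjoint_op_le hd φ (a := t + L - κ * L) (by linarith) (mul_pos hκ0 hL)
    (by linarith) fun y hy => hbound n φ t L ht hL (hLδ.trans_le (min_le_left _ _)) A hAm hA hv y
      ⟨hy.1, by linarith [hy.2]⟩
  rw [sub_add_cancel, Real.mul_rpow hκ0.le hL.le, ← div_div] at hobsL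
  exact hobsL.trans_eq (by ring)

theorem IsAnalytic.exists_norm_adjoint_op_le_setIntegral (hS : S.IsAnalytic)
    {B : U →L[𝕜] S.Xneg} {d k : ℝ} (hd : 0 ≤ d) (hk : 0 < k) (hobs : S.IsObservable B d k)
    {E : Set ℝ} (hE : MeasurableSet E) (hE0 : volume E ≠ 0) {T : ℝ≥0}
    (hET : E ⊆ Set.Ioo 0 (T : ℝ)) :
    ∃ C : ℝ, 0 < C ∧ ∀ φ : S.adjointDomain,
      ‖(S.op T).adjoint (S.incl φ)‖ ≤ C * ∫ t in E, ‖output B φ t‖ := by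
  obtain ⟨κ, δ, c, D, hκ0, hκ1, hδ0, hδ1, hc, hD, hinterp⟩ :=
    hS.exists_interpolationEstimate hd hobs
  obtain ⟨τ, hτ, C, hC, hτC⟩ := exists_le_mul_setIntegral_of_interpolation hE hE0 hET hκ0 hκ1
    hδ0 hδ1 (Λ := 48) (by norm_num) hc hD hk
  obtain ⟨K, hK, hKop⟩ := S.exists_norm_op_le T
  have hadj : ∀ t ≤ T, ∀ x, ‖(S.op t).adjoint x‖ ≤ K * ‖x‖ := fun t ht =>
    (S.op t).adjoint.le_of_opNorm_le ((norm_adjoint_op t).trans_le (hKop t ht))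
  refine ⟨K * C, by positivity, fun φ => ?_⟩
  have hE_int : IntegrableOn (fun t => ‖output B φ t‖) E :=
    memLp_one_iff_integrable.1
      (hS.memLp_output B φ hE (hET.trans Set.Ioo_subset_Ioc_self) 1).norm
  have hop : (S.op T).adjoint (S.incl φ) =
      (S.op (T - τ.toNNReal)).adjoint ((S.op τ.toNNReal).adjoint (S.incl φ)) := by
    rw [← incl_adjointOp, ← incl_adjointOp, ← incl_adjointOp, ← adjointOp_add,
      tsub_add_cancel_of_le (Real.toNNReal_le_iff_le_coe.2 hτ.2)]
  rw [hop, mul_assoc]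
  refine (hadj _ tsub_le_self _).trans (mul_le_mul_of_nonneg_left ?_ hK.le)
  exact hτC _ _ (hinterp φ) (fun _ => norm_nonneg _) (fun _ => norm_nonneg _)
    ⟨K * ‖S.incl φ‖, fun t ht => hadj _ (Real.toNNReal_le_iff_le_coe.2 ht.2) _⟩ hE_int

end C0Semigroup

theorem exists_norm_le_mul_of_forall_exists_norm_apply_le {𝕜 E F ι : Type*} [RCLike 𝕜]
    [NormedAddCommGroup E] [NormedSpace 𝕜 E] [CompleteSpace E] [NormedAddCommGroup F]
    [NormedSpace 𝕜 F] {l : ι → E →L[𝕜] F} {N : ι → ℝ} (hN : ∀ i, 0 ≤ N i)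
    (h : ∀ x, ∃ C, ∀ i, ‖l i x‖ ≤ C * N i) : ∃ C, 0 ≤ C ∧ ∀ i, ‖l i‖ ≤ C * N i := by
  obtain ⟨C, hC⟩ := banach_steinhaus (g := fun i => (((N i)⁻¹ : ℝ) : 𝕜) • l i) fun x => by
    obtain ⟨C, hC⟩ := h x
    refine ⟨|C|, fun i => ?_⟩
    rw [smul_apply, norm_smul, RCLike.norm_ofReal, abs_of_nonneg (inv_nonneg.2 (hN i))]
    refine inv_mul_le_of_le_mul₀ (hN i) (abs_nonneg C) ((hC i).trans ?_)
    rw [mul_comm]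
    exact mul_le_mul_of_nonneg_left (le_abs_self C) (hN i)
  refine ⟨max C 0, le_max_right _ _, fun i => ?_⟩
  rcases (hN i).eq_or_lt with h0 | hpos
  · refine (l i).opNorm_le_bound (by rw [← h0, mul_zero]) fun x => ?_
    obtain ⟨C', hC'⟩ := h x
    simpa [← h0] using hC' i
  · have hi := hC i
    rw [norm_smul, RCLike.norm_ofReal, abs_of_pos (by positivity),
      inv_mul_le_iff₀ hpos, mul_comm] at hi
    exact hi.trans (mul_le_mul_of_nonneg_right (le_max_left _ _) hpos.le)

theorem intervalIntegrable_of_norm_le {E : Type*} [NormedAddCommGroup E] {f : ℝ → E}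
    (hf : StronglyMeasurable f) {M : ℝ} (hM : ∀ s, ‖f s‖ ≤ M) (a b : ℝ) :
    IntervalIntegrable f volume a b :=
  (intervalIntegrable_const (c := M)).mono_fun' hf.aestronglyMeasurable (Eventually.of_forall hM)

theorem intervalIntegrable_comp_add_right {E : Type*} [NormedAddCommGroup E] {f : ℝ → E}
    {a b : ℝ≥0} (hf : IntervalIntegrable f volume 0 (b + a : ℝ≥0)) :
    IntervalIntegrable (fun s => f (s + a)) volume 0 b := by
  have ha : (a : ℝ) ∈ Set.uIcc (0 : ℝ) (b + a : ℝ≥0) := by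
    rw [Set.uIcc_of_le (NNReal.coe_nonneg _)]
    exact ⟨a.coe_nonneg, NNReal.coe_le_coe.2 le_add_self⟩
  simpa using (hf.mono_set (Set.uIcc_subset_uIcc_right ha)).comp_add_right (a : ℝ)

namespace C0Semigroup

variable {𝕜 : Type*} [RCLike 𝕜] {X : Type*} [NormedAddCommGroup X] [InnerProductSpace 𝕜 X]
  [CompleteSpace X] {S : C0Semigroup 𝕜 X}

theorem embed_apply (x : X) (φ : S.adjointDomain) : S.embed x φ = inner 𝕜 (S.incl φ) x := rfl

theorem embed_add (x y : X) : S.embed (x + y) = S.embed x + S.embed y := by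
  ext φ
  exact inner_add_right _ _ _

theorem opNeg_embed (t : ℝ≥0) (x : X) : S.opNeg t (S.embed x) = S.embed (S.op t x) := by
  ext φ
  exact ContinuousLinearMap.adjoint_inner_left _ _ _

theorem exists_embed_eq {ξ : S.Xneg} {C : ℝ} (hC : 0 ≤ C)
    (h : ∀ φ, ‖ξ φ‖ ≤ C * ‖S.incl φ‖) : ∃ x : X, ‖x‖ ≤ C ∧ S.embed x = ξ := by
  obtain ⟨x, hx, hxξ⟩ := exists_inner_eq_of_norm_le (S.incl : S.adjointDomain →ₗ[𝕜] X)
    (ξ : S.adjointDomain →ₗ⋆[𝕜] 𝕜) hC h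
  exact ⟨x, hx, ContinuousLinearMap.ext hxξ⟩

variable {U : Type*} [NormedAddCommGroup U] [InnerProductSpace 𝕜 U]

theorem inputMap_congr {B : U →L[𝕜] S.Xneg} {f g : ℝ → U} (T : ℝ≥0)
    (h : f =ᵐ[volume.restrict (Set.Ioi (0 : ℝ))] g) : S.inputMap B T f = S.inputMap B T g := by
  refine intervalIntegral.integral_congr_ae ?_
  filter_upwards [(ae_restrict_iff' measurableSet_Ioi).1 h] with t ht htm
  rw [Set.uIoc_of_le T.coe_nonneg] at htm
  rw [ht htm.1]

variable [CompleteSpace U]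

theorem IsAnalytic.continuousOn_adjointOp_sub (hS : S.IsAnalytic) (T : ℝ) :
    ContinuousOn (fun t : ℝ => S.adjointOp (T - t).toNNReal) (Set.Ioo 0 T) :=
  hS.continuousOn_adjointOp.comp (by fun_prop) fun _ ht => Real.toNNReal_pos.2 (sub_pos.2 ht.2)

theorem exists_norm_adjointOp_sub_le (S : C0Semigroup 𝕜 X) (T : ℝ≥0) :
    ∃ C, ∀ t ∈ Set.Ioc (0 : ℝ) T, ‖S.adjointOp (T - t).toNNReal‖ ≤ C := by
  obtain ⟨C, -, hC⟩ := S.exists_norm_op_le T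
  exact ⟨C, fun t ht => (norm_adjointOp_le _).trans
    (hC _ (Real.toNNReal_le_iff_le_coe.2 (by linarith [ht.1])))⟩

theorem IsAnalytic.intervalIntegrable_inner_output (hS : S.IsAnalytic) (B : U →L[𝕜] S.Xneg)
    {T : ℝ≥0} {f : ℝ → U} (hf : IntervalIntegrable f volume 0 T) (φ : S.adjointDomain) :
    IntervalIntegrable (fun r => inner 𝕜 (output B φ r) (f (T - r))) volume 0 T := by
  obtain ⟨C, hC⟩ := S.exists_norm_adjointOp_sub_le T
  have hint : IntervalIntegrable
      (fun t => B (f t) (S.adjointOp ((T : ℝ) - t).toNNReal φ)) volume 0 (T : ℝ) :=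
    intervalIntegrable_control_comp_apply B T.coe_nonneg hf
      (hS.continuousOn_adjointOp_sub T) hC φ
  have hrev := (hint.comp_sub_left T).symm
  simp only [sub_self, sub_zero, sub_sub_cancel] at hrev
  exact hrev.congr fun r _ => (inner_output B φ r _).symm

theorem IsAnalytic.inputMap_apply (hS : S.IsAnalytic) (B : U →L[𝕜] S.Xneg) {T : ℝ≥0}
    {f : ℝ → U} (hf : IntervalIntegrable f volume 0 T) (φ : S.adjointDomain) :
    S.inputMap B T f φ = ∫ r in (0 : ℝ)..T, inner 𝕜 (output B φ r) (f (T - r)) := by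
  obtain ⟨C, hC⟩ := S.exists_norm_adjointOp_sub_le T
  calc S.inputMap B T f φ
      = ∫ t in (0 : ℝ)..T, B (f t) (S.adjointOp ((T : ℝ) - t).toNNReal φ) :=
        intervalIntegral_control_comp_apply B T.coe_nonneg hf
          (hS.continuousOn_adjointOp_sub T) hC φ
    _ = ∫ t in (0 : ℝ)..T, inner 𝕜 (output B φ (T - t)) (f (T - (T - t))) := by
        simp only [inner_output, sub_sub_cancel]
    _ = ∫ r in (0 : ℝ)..T, inner 𝕜 (output B φ r) (f (T - r)) := by
        rw [intervalIntegral.integral_comp_sub_left fun r => inner 𝕜 (output B φ r) (f (T - r)),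
          sub_self, sub_zero]

theorem IsAnalytic.inputMap_add (hS : S.IsAnalytic) (B : U →L[𝕜] S.Xneg) {T : ℝ≥0}
    {f g : ℝ → U} (hf : IntervalIntegrable f volume 0 T) (hg : IntervalIntegrable g volume 0 T) :
    S.inputMap B T (fun s => f s + g s) = S.inputMap B T f + S.inputMap B T g := by
  ext φ
  rw [add_apply, hS.inputMap_apply B hf, hS.inputMap_apply B hg,
    hS.inputMap_apply B (hf.add hg), ← intervalIntegral.integral_add
      (hS.intervalIntegrable_inner_output B hf φ) (hS.intervalIntegrable_inner_output B hg φ)]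
  simp only [inner_add_right]

theorem IsAnalytic.inputMap_add_time (hS : S.IsAnalytic) (B : U →L[𝕜] S.Xneg) {a b : ℝ≥0}
    {f : ℝ → U} (hf : IntervalIntegrable f volume 0 (b + a : ℝ≥0)) :
    S.inputMap B (b + a) f =
      S.opNeg b (S.inputMap B a f) + S.inputMap B b (fun s => f (s + a)) := by
  ext φ
  have hba : ((b + a : ℝ≥0) : ℝ) = b + a := NNReal.coe_add b a
  have hb : (b : ℝ) ∈ Set.uIcc (0 : ℝ) (b + a : ℝ≥0) := by
    rw [hba, Set.uIcc_of_le (by positivity)]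
    exact ⟨b.coe_nonneg, by linarith [a.coe_nonneg]⟩
  have ha : (a : ℝ) ∈ Set.uIcc (0 : ℝ) (b + a : ℝ≥0) := by
    rw [hba, Set.uIcc_of_le (by positivity)]
    exact ⟨a.coe_nonneg, by linarith [b.coe_nonneg]⟩
  have hfa : IntervalIntegrable f volume 0 a := hf.mono_set (Set.uIcc_subset_uIcc_left ha)
  have hfb := intervalIntegrable_comp_add_right hf
  have hint := hS.intervalIntegrable_inner_output B hf φ
  have hlate : ∫ r in (b : ℝ)..(b + a : ℝ≥0), inner 𝕜 (output B φ r) (f ((b + a : ℝ≥0) - r)) =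
      S.opNeg b (S.inputMap B a f) φ := by
    calc _ = ∫ r in (0 : ℝ)..a, inner 𝕜 (output B φ (r + b)) (f ((b + a : ℝ≥0) - (r + b))) := by
          rw [intervalIntegral.integral_comp_add_right
            fun r => inner 𝕜 (output B φ r) (f ((b + a : ℝ≥0) - r)), zero_add, hba,
            add_comm (a : ℝ)]
      _ = ∫ r in (0 : ℝ)..a, inner 𝕜 (output B (S.adjointOp b φ) r) (f (a - r)) := by
          refine intervalIntegral.integral_congr fun r hr => ?_
          rw [Set.uIcc_of_le a.coe_nonneg] at hr
          simp only [output_add_time B φ hr.1 b.coe_nonneg, Real.toNNReal_coe, hba]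
          congr 2
          ring
      _ = S.opNeg b (S.inputMap B a f) φ := (hS.inputMap_apply B hfa _).symm
  rw [hS.inputMap_apply B hf, ← intervalIntegral.integral_add_adjacent_intervals
    (hint.mono_set (Set.uIcc_subset_uIcc_left hb)) (hint.mono_set (Set.uIcc_subset_uIcc_right hb)),
    hlate, add_comm, add_apply, hS.inputMap_apply B hfb]
  simp only [hba, sub_add_eq_add_sub]

theorem IsAnalytic.state_add_time (hS : S.IsAnalytic) (B : U →L[𝕜] S.Xneg) {a b : ℝ≥0}
    {f : ℝ → U} (hf : IntervalIntegrable f volume 0 (b + a : ℝ≥0)) {z₀ z : X}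
    (hz : S.state B z₀ f a = S.embed z) :
    S.state B z₀ f (b + a) = S.state B z (fun s => f (s + a)) b := by
  have hneg : S.opNeg b (S.state B z₀ f a) =
      S.opNeg b (S.embed (S.op a z₀)) + S.opNeg b (S.inputMap B a f) := rfl
  rw [hz, opNeg_embed, opNeg_embed] at hneg
  rw [state, state, hS.inputMap_add_time B hf, hneg, S.op_add, add_assoc]
  rfl

theorem IsAnalytic.exists_eLpNorm_output_le (hS : S.IsAnalytic) {B : U →L[𝕜] S.Xneg}
    (hB : S.IsAdmissibleControl B) : ∃ τ : ℝ≥0, 0 < τ ∧ ∃ K : ℝ, 0 ≤ K ∧ ∀ φ,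
      (eLpNorm (output B φ) 2 (volume.restrict (Set.Ioo (0 : ℝ) τ))).toReal ≤
        K * ‖S.incl φ‖ := by
  obtain ⟨τ, hτ, hadm⟩ := hB
  set μ := volume.restrict (Set.Ioo (0 : ℝ) τ)
  have hmem : ∀ φ, MemLp (output B φ) 2 μ := fun φ =>
    hS.memLp_output B φ measurableSet_Ioo Set.Ioo_subset_Ioc_self 2
  have hrev : MeasurePreserving (fun s : ℝ => (τ : ℝ) - s) μ μ := by
    have := (Measure.measurePreserving_sub_left volume (τ : ℝ)).restrict_preimage
      (measurableSet_Ioo (a := (0 : ℝ)) (b := τ))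
    simpa using this
  obtain ⟨K, hK, hKb⟩ := exists_norm_le_mul_of_forall_exists_norm_apply_le
    (l := fun φ => innerSL 𝕜 ((hmem φ).toLp _)) (fun φ => norm_nonneg (S.incl φ)) fun f => by
      have hf := (Lp.memLp f).comp_measurePreserving hrev
      obtain ⟨x, hx⟩ := hadm _ hf
      refine ⟨‖x‖, fun φ => ?_⟩
      have hfi : IntervalIntegrable (f ∘ fun s => (τ : ℝ) - s) volume 0 τ := by
        rw [intervalIntegrable_iff_integrableOn_Ioo_of_le τ.coe_nonneg]
        exact hf.integrable one_le_two
      have hinner : inner 𝕜 ((hmem φ).toLp _) f = inner 𝕜 (S.incl φ) x := by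
        rw [← embed_apply, hx, hS.inputMap_apply B hfi, L2.inner_def,
          intervalIntegral.integral_of_le τ.coe_nonneg, integral_Ioc_eq_integral_Ioo]
        refine integral_congr_ae ?_
        filter_upwards [(hmem φ).coeFn_toLp] with r hr
        rw [hr, Function.comp_apply, sub_sub_cancel]
      rw [innerSL_apply_apply, hinner, mul_comm]
      exact norm_inner_le_norm _ _
  refine ⟨τ, hτ, K, hK, fun φ => ?_⟩
  rw [← Lp.norm_toLp _ (hmem φ), ← innerSL_apply_norm 𝕜]
  exact hKb φ

theorem IsAnalytic.exists_embed_eq_inputMap (hS : S.IsAnalytic) {B : U →L[𝕜] S.Xneg}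
    (hB : S.IsAdmissibleControl B) : ∃ τ : ℝ≥0, 0 < τ ∧ ∃ K : ℝ, 0 ≤ K ∧
      ∀ (f : ℝ → U) (M : ℝ), StronglyMeasurable f → (∀ s, ‖f s‖ ≤ M) → ∀ δ ≤ τ,
        ∃ x : X, ‖x‖ ≤ M * (√δ * K) ∧ S.embed x = S.inputMap B δ f := by
  obtain ⟨τ, hτ, K, hK, hKφ⟩ := hS.exists_eLpNorm_output_le hB
  refine ⟨τ, hτ, K, hK, fun f M hf hM δ hδ => ?_⟩
  have hM0 : 0 ≤ M := (norm_nonneg _).trans (hM 0)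
  refine exists_embed_eq (by positivity) fun φ => ?_
  have hmem : ∀ p, MemLp (output B φ) p (volume.restrict (Set.Ioo (0 : ℝ) δ)) :=
    hS.memLp_output B φ measurableSet_Ioo Set.Ioo_subset_Ioc_self
  have hL2 : (eLpNorm (output B φ) 2 (volume.restrict (Set.Ioo (0 : ℝ) δ))).toReal ≤
      K * ‖S.incl φ‖ := by
    refine (ENNReal.toReal_mono ?_ ?_).trans (hKφ φ)
    · exact (hS.memLp_output B φ measurableSet_Ioo Set.Ioo_subset_Ioc_self 2).2.ne
    · exact eLpNorm_mono_measure _ (Measure.restrict_mono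
        (Set.Ioo_subset_Ioo_right (NNReal.coe_le_coe.2 hδ)) le_rfl)
  rw [hS.inputMap_apply B (intervalIntegrable_of_norm_le hf hM _ _),
    intervalIntegral.integral_of_le δ.coe_nonneg, integral_Ioc_eq_integral_Ioo]
  calc ‖∫ r in Set.Ioo (0 : ℝ) δ, inner 𝕜 (output B φ r) (f (δ - r))‖
      ≤ ∫ r in Set.Ioo (0 : ℝ) δ, M * ‖output B φ r‖ := by
        refine norm_integral_le_of_norm_le
          ((memLp_one_iff_integrable.1 (hmem 1).norm).const_mul M)
          (Eventually.of_forall fun r => ?_)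
        rw [mul_comm]
        exact (norm_inner_le_norm _ _).trans (by gcongr; exact hM _)
    _ = M * ∫ r in Set.Ioo (0 : ℝ) δ, ‖output B φ r‖ := integral_const_mul _ _
    _ ≤ M * (√δ * (K * ‖S.incl φ‖)) := by
        gcongr
        refine (integral_norm_le_sqrt_mul_eLpNorm (hmem 2)).trans ?_
        rw [measureReal_restrict_apply_univ, Real.volume_real_Ioo_of_le δ.coe_nonneg, sub_zero]
        gcongr
    _ = M * (√δ * K) * ‖S.incl φ‖ := by ring

end C0Semigroup

section Slack

variable {U : Type*} [NormedAddCommGroup U]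

theorem exists_bounded_ae_eq_of_mem_controls {f : ℝ → U} {M : ℝ} (hM : 0 ≤ M)
    (hf : f ∈ C0Semigroup.controls U M) :
    ∃ g : ℝ → U, StronglyMeasurable g ∧ (∀ s, ‖g s‖ ≤ M) ∧
      f =ᵐ[volume.restrict (Set.Ioi (0 : ℝ))] g := by
  obtain ⟨hfm, hfM⟩ := hf
  have hA : MeasurableSet {s | ‖hfm.mk f s‖ ≤ M} :=
    measurableSet_le hfm.stronglyMeasurable_mk.norm.measurable measurable_const
  refine ⟨{s | ‖hfm.mk f s‖ ≤ M}.indicator (hfm.mk f), hfm.stronglyMeasurable_mk.indicator hA,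
    fun s => ?_, ?_⟩
  · by_cases hs : s ∈ {s | ‖hfm.mk f s‖ ≤ M}
    · rwa [Set.indicator_of_mem hs]
    · rwa [Set.indicator_of_notMem hs, norm_zero]
  · filter_upwards [hfM, hfm.ae_eq_mk] with s hsM hs
    rw [Set.indicator_of_mem (by simpa [← hs] using hsM), hs]

theorem exists_measure_norm_le_sub_ne_zero {g : ℝ → U} {M T : ℝ} (hg : ∀ s, ‖g s‖ ≤ M)
    (h : ¬ ∀ᵐ t ∂(volume.restrict (Set.Ioo (0 : ℝ) T)), ‖g t‖ = M) :
    ∃ ε : ℝ, 0 < ε ∧ volume {s ∈ Set.Ioo ε T | ‖g s‖ ≤ M - ε} ≠ 0 := by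
  contrapose! h
  rw [ae_restrict_iff' measurableSet_Ioo, ae_iff]
  refine measure_mono_null (t := ⋃ n : ℕ, {s ∈ Set.Ioo (1 / ((n : ℝ) + 1)) T |
    ‖g s‖ ≤ M - 1 / ((n : ℝ) + 1)}) (fun s hs => ?_)
    (measure_iUnion_null fun n => h _ (by positivity))
  obtain ⟨hs0T, hsM⟩ := Classical.not_imp.1 hs
  have hgap : 0 < M - ‖g s‖ := sub_pos.2 ((hg s).lt_of_ne hsM)
  obtain ⟨n, hn⟩ := exists_nat_one_div_lt (lt_min hs0T.1 hgap)
  have hns := hn.trans_le (min_le_left _ _)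
  have hng := hn.trans_le (min_le_right _ _)
  exact Set.mem_iUnion.2 ⟨n, ⟨hns, hs0T.2⟩, by linarith⟩

theorem exists_slack_set {f : ℝ → U} {M : ℝ} {T : ℝ≥0} (hf : StronglyMeasurable f)
    (hM : ∀ s, ‖f s‖ ≤ M)
    (h : ¬ ∀ᵐ t ∂(volume.restrict (Set.Ioo (0 : ℝ) T)), ‖f t‖ = M) :
    ∃ (ε : ℝ≥0) (E : Set ℝ), 0 < ε ∧ ε < T ∧ MeasurableSet E ∧ volume E ≠ 0 ∧
      E ⊆ Set.Ioo 0 ((T - ε : ℝ≥0) : ℝ) ∧ ∀ r ∈ E, ‖f (T - r)‖ ≤ M - ε := by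
  obtain ⟨ε, hε, hvol⟩ := exists_measure_norm_le_sub_ne_zero hM h
  set A := {s ∈ Set.Ioo ε (T : ℝ) | ‖f s‖ ≤ M - ε}
  have hA : MeasurableSet A :=
    measurableSet_Ioo.inter (measurableSet_le hf.norm.measurable measurable_const)
  have hrev := Measure.measurePreserving_sub_left volume (T : ℝ)
  obtain ⟨s, hs, -⟩ := nonempty_of_measure_ne_zero hvol
  lift ε to ℝ≥0 using hε.le
  have hεT : ε < T := NNReal.coe_lt_coe.1 (hs.1.trans hs.2)
  refine ⟨ε, (fun r => (T : ℝ) - r) ⁻¹' A, hε, hεT, hA.preimage hrev.measurable,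
    by rwa [hrev.measure_preimage hA.nullMeasurableSet], fun r hr => ?_, fun r hr => hr.2⟩
  rw [NNReal.coe_sub hεT.le]
  exact ⟨by linarith [hr.1.2], by linarith [hr.1.1]⟩

end Slack

namespace C0Semigroup

variable {𝕜 : Type*} [RCLike 𝕜] {X : Type*} [NormedAddCommGroup X] [InnerProductSpace 𝕜 X]
  [CompleteSpace X] {S : C0Semigroup 𝕜 X}
variable {U : Type*} [NormedAddCommGroup U] [InnerProductSpace 𝕜 U] [CompleteSpace U]

theorem IsAnalytic.exists_control_of_norm_inner_le (hS : S.IsAnalytic) (B : U →L[𝕜] S.Xneg)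
    {E : Set ℝ} (hE : MeasurableSet E) {T : ℝ≥0} (hET : E ⊆ Set.Ioo 0 (T : ℝ)) {x : X} {C : ℝ}
    (hC : 0 ≤ C) (h : ∀ φ, ‖inner 𝕜 (S.incl φ) x‖ ≤ C * ∫ t in E, ‖output B φ t‖) :
    ∃ w : ℝ → U, StronglyMeasurable w ∧ (∀ t, ‖w t‖ ≤ C) ∧
      ∀ φ, ∫ t in E, inner 𝕜 (output B φ t) (w t) = inner 𝕜 (S.incl φ) x := by
  have : IsFiniteMeasure (volume.restrict E) :=
    isFiniteMeasure_restrict.2 (measure_ne_top_of_subset hET (by simp))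
  have hmem : ∀ φ, MemLp (output B φ) 2 (volume.restrict E) := fun φ =>
    hS.memLp_output B φ hE (hET.trans Set.Ioo_subset_Ioc_self) 2
  let Φ : S.adjointDomain →ₗ[𝕜] Lp U 2 (volume.restrict E) :=
    { toFun := fun φ => (hmem φ).toLp _
      map_add' := fun φ ψ => by
        rw [← MemLp.toLp_add, MemLp.toLp_eq_toLp_iff]
        exact Eventually.of_forall (output_add B φ ψ)
      map_smul' := fun c φ => by
        rw [RingHom.id_apply, ← MemLp.toLp_const_smul, MemLp.toLp_eq_toLp_iff]
        exact Eventually.of_forall (output_smul B c φ) }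
  have hΦ : ∀ φ, Φ φ =ᵐ[volume.restrict E] output B φ := fun φ => (hmem φ).coeFn_toLp
  obtain ⟨w, hw, hwC, hwl⟩ := exists_bounded_representation Φ
    ((innerSL 𝕜 x ∘L S.incl : S.adjointDomain →L[𝕜] 𝕜) : S.adjointDomain →ₗ[𝕜] 𝕜) hC fun φ => by
      have hL1 : ∫ t in E, ‖Φ φ t‖ = ∫ t in E, ‖output B φ t‖ :=
        integral_congr_ae ((hΦ φ).fun_comp norm)
      rw [hL1]
      exact (norm_inner_symm x (S.incl φ)).trans_le (h φ)
  refine ⟨w, hw, hwC, fun φ => ?_⟩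
  have hwφ : inner 𝕜 x (S.incl φ) = ∫ t in E, inner 𝕜 (w t) (Φ φ t) := hwl φ
  rw [← inner_conj_symm (S.incl φ), hwφ, ← integral_conj]
  refine integral_congr_ae ?_
  filter_upwards [hΦ φ] with t ht
  rw [inner_conj_symm, ht]

theorem IsAnalytic.inputMap_indicator_apply (hS : S.IsAnalytic) (B : U →L[𝕜] S.Xneg)
    {E : Set ℝ} (hE : MeasurableSet E) {T : ℝ≥0} (hET : E ⊆ Set.Ioo 0 (T : ℝ)) {w : ℝ → U}
    (hw : StronglyMeasurable w) {C : ℝ} (hC : ∀ t, ‖w t‖ ≤ C) (φ : S.adjointDomain) :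
    S.inputMap B T (fun s => E.indicator w (T - s)) φ =
      ∫ t in E, inner 𝕜 (output B φ t) (w t) := by
  have hwT : StronglyMeasurable fun s => E.indicator w (T - s) :=
    (hw.indicator hE).comp_measurable (measurable_const.sub measurable_id)
  have hind : (fun t => inner 𝕜 (output B φ t) (E.indicator w t)) =
      E.indicator fun t => inner 𝕜 (output B φ t) (w t) := by
    ext t
    by_cases ht : t ∈ E <;> simp [ht]
  rw [hS.inputMap_apply B (intervalIntegrable_of_norm_le hwT
    (fun s => (norm_indicator_le_norm_self w _).trans (hC _)) _ _),
    intervalIntegral.integral_of_le T.coe_nonneg]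
  simp only [sub_sub_cancel]
  rw [hind, setIntegral_indicator hE,
    Set.inter_eq_right.2 (hET.trans Set.Ioo_subset_Ioc_self)]

theorem IsAnalytic.exists_small_control (hS : S.IsAnalytic) {B : U →L[𝕜] S.Xneg} {d k : ℝ}
    (hd : 0 ≤ d) (hk : 0 < k) (hobs : S.IsObservable B d k) {E : Set ℝ} (hE : MeasurableSet E)
    (hE0 : volume E ≠ 0) {T₀ : ℝ≥0} (hET : E ⊆ Set.Ioo 0 (T₀ : ℝ)) (T : ℝ≥0) :
    ∃ C, 0 < C ∧ ∀ t, T₀ ≤ t → t ≤ T → ∀ x : X, ∃ w : ℝ → U, StronglyMeasurable w ∧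
      (∀ r, ‖w r‖ ≤ C * ‖x‖) ∧ (∀ r ∉ E, w r = 0) ∧
        S.inputMap B t (fun s => w (t - s)) = S.embed (S.op t x) := by
  obtain ⟨C, hC, hCφ⟩ := hS.exists_norm_adjoint_op_le_setIntegral hd hk hobs hE hE0 hET
  obtain ⟨C', hC', hop⟩ := S.exists_norm_op_le T
  refine ⟨C * C', by positivity, fun t hT₀t htT x => ?_⟩
  have hsplit : S.op t x = S.op T₀ (S.op (t - T₀) x) := by
    rw [← ContinuousLinearMap.comp_apply, ← S.op_add, add_tsub_cancel_of_le hT₀t]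
  have hx : ‖S.op (t - T₀) x‖ ≤ C' * ‖x‖ :=
    ContinuousLinearMap.le_of_opNorm_le _ (hop _ (tsub_le_self.trans htT)) x
  obtain ⟨w, hw, hwC, hwE⟩ := hS.exists_control_of_norm_inner_le B hE hET (x := S.op t x)
    (C := C * C' * ‖x‖) (by positivity) fun φ => by
      have : 0 ≤ ∫ r in E, ‖output B φ r‖ := integral_nonneg fun _ => norm_nonneg _
      rw [hsplit, ← ContinuousLinearMap.adjoint_inner_left]
      calc _ ≤ ‖(S.op T₀).adjoint (S.incl φ)‖ * ‖S.op (t - T₀) x‖ := norm_inner_le_norm _ _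
        _ ≤ (C * ∫ r in E, ‖output B φ r‖) * (C' * ‖x‖) := by gcongr; exact hCφ φ
        _ = C * C' * ‖x‖ * ∫ r in E, ‖output B φ r‖ := by ring
  refine ⟨E.indicator w, hw.indicator hE, fun r => (norm_indicator_le_norm_self w r).trans (hwC r),
    fun r hr => Set.indicator_of_notMem hr w, ContinuousLinearMap.ext fun φ => ?_⟩
  rw [hS.inputMap_indicator_apply B hE (hET.trans (Set.Ioo_subset_Ioo_right hT₀t)) hw hwC, hwE,
    embed_apply]

theorem IsAnalytic.eventually_exists_state_eq (hS : S.IsAnalytic) {B : U →L[𝕜] S.Xneg}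
    (hB : S.IsAdmissibleControl B) {f : ℝ → U} {M : ℝ} (hf : StronglyMeasurable f)
    (hM : ∀ s, ‖f s‖ ≤ M) (z₀ : X) {η : ℝ} (hη : 0 < η) :
    ∀ᶠ δ : ℝ≥0 in 𝓝 0, ∃ z, ‖z - z₀‖ < η ∧ S.state B z₀ f δ = S.embed z := by
  obtain ⟨τ, hτ, K, -, hinput⟩ := hS.exists_embed_eq_inputMap hB
  have hcont : Continuous fun δ : ℝ≥0 => ‖S.op δ z₀ - z₀‖ + M * (√δ * K) := by
    have := S.continuous_orbit z₀
    fun_prop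
  have hlim := hcont.tendsto' 0 0 (by simp [S.op_zero])
  filter_upwards [hlim.eventually_lt_const hη, Iio_mem_nhds hτ] with δ hδη hδτ
  obtain ⟨x, hx, hxf⟩ := hinput f M hf hM δ (le_of_lt hδτ)
  refine ⟨S.op δ z₀ + x, ?_, by rw [state, embed_add, hxf]⟩
  rw [add_sub_right_comm]
  exact ((norm_add_le _ _).trans (add_le_add_right hx _)).trans_lt hδη

theorem IsAnalytic.state_shift_add (hS : S.IsAnalytic) (B : U →L[𝕜] S.Xneg) {a b : ℝ≥0}
    {f w : ℝ → U} (hf : IntervalIntegrable f volume 0 (b + a : ℝ≥0))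
    (hw : IntervalIntegrable w volume 0 b) {z₀ z : X} (hz : S.state B z₀ f a = S.embed z)
    (hwz : S.inputMap B b w = S.embed (S.op b (z - z₀))) :
    S.state B z₀ (fun s => f (s + a) + w s) b = S.state B z₀ f (b + a) := by
  rw [hS.state_add_time B hf hz, state, state,
    hS.inputMap_add B (intervalIntegrable_comp_add_right hf) hw, hwz, add_left_comm,
    ← embed_add, ← map_add, add_sub_cancel, add_comm]

theorem IsAnalytic.exists_mem_reachTimes_lt (hS : S.IsAnalytic) {B : U →L[𝕜] S.Xneg}
    (hB : S.IsAdmissibleControl B) {d k : ℝ} (hd : 0 ≤ d) (hk : 0 < k)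
    (hobs : S.IsObservable B d k) {z₀ z₁ : X} {M : ℝ} {T : ℝ≥0} {f : ℝ → U}
    (hf : StronglyMeasurable f) (hM : ∀ s, ‖f s‖ ≤ M) (hz : S.state B z₀ f T = S.embed z₁)
    (hbb : ¬ ∀ᵐ t ∂(volume.restrict (Set.Ioo (0 : ℝ) T)), ‖f t‖ = M) :
    ∃ t ∈ S.reachTimes B z₀ z₁ M, t < T := by
  obtain ⟨ε, E, hε, hεT, hE, hE0, hET, hfE⟩ := exists_slack_set hf hM hbb
  obtain ⟨C, hC, hcontrol⟩ := hS.exists_small_control hd hk hobs hE hE0 hET T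
  obtain ⟨δ, ⟨⟨z, hzη, hzδ⟩, hδε⟩, hδ0⟩ := (((hS.eventually_exists_state_eq hB hf hM z₀
    (show 0 < ε / C by positivity)).and (Iio_mem_nhds hε)).filter_mono nhdsWithin_le_nhds).and
      (self_mem_nhdsWithin (s := Set.Ioi (0 : ℝ≥0))) |>.exists
  have hδT : δ < T := lt_trans hδε hεT
  obtain ⟨w, hw, hwC, hwE, hwz⟩ := hcontrol (T - δ) (tsub_le_tsub_left (le_of_lt hδε) T)
    tsub_le_self (z - z₀)
  have hwε : ∀ r, ‖w r‖ ≤ ε := fun r =>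
    (hwC r).trans ((lt_div_iff₀' hC).1 hzη).le
  set v : ℝ → U := fun s => f (s + δ) + w ((T - δ : ℝ≥0) - s) with hv
  have hwm : StronglyMeasurable fun s => w ((T - δ : ℝ≥0) - s) :=
    hw.comp_measurable (measurable_const.sub measurable_id)
  have hvm : StronglyMeasurable v :=
    (hf.comp_measurable (measurable_id.add_const _)).add hwm
  have hvM : ∀ s, ‖v s‖ ≤ M := fun s => by
    by_cases hs : ((T - δ : ℝ≥0) - s : ℝ) ∈ E
    · have hfs := hfE _ hs
      rw [NNReal.coe_sub hδT.le, show (T : ℝ) - (T - δ - s) = s + δ by ring] at hfs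
      linarith [norm_add_le (f (s + δ)) (w ((T - δ : ℝ≥0) - s)), hwε ((T - δ : ℝ≥0) - s)]
    · simpa only [hv, hwE _ hs, add_zero] using hM _
  refine ⟨T - δ, ⟨tsub_pos_of_lt hδT, v, ⟨hvm.aestronglyMeasurable, Eventually.of_forall hvM⟩, ?_⟩,
    tsub_lt_self (hδ0.trans hδT) hδ0⟩
  rw [hS.state_shift_add B (intervalIntegrable_of_norm_le hf hM _ _)
    (intervalIntegrable_of_norm_le hwm (fun s => hwε _) _ _) hzδ hwz,
    tsub_add_cancel_of_le hδT.le, hz]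

end C0Semigroup

theorem theorem3p1 {𝕜 : Type*} [RCLike 𝕜]
    {X : Type*} [NormedAddCommGroup X] [InnerProductSpace 𝕜 X] [CompleteSpace X]
    {U : Type*} [NormedAddCommGroup U] [InnerProductSpace 𝕜 U] [CompleteSpace U]
    (S : C0Semigroup 𝕜 X) (hS : S.IsAnalytic)
    (B : U →L[𝕜] S.Xneg) (hB : S.IsAdmissibleControl B)
    (d k : ℝ) (hd : 0 < d) (hk : 0 < k) (hobs : S.IsObservable B d k)
    (z₀ z₁ : X) (hz : z₁ ≠ z₀) (M : ℝ) (hM : 0 < M) :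
    S.BangBang B z₀ z₁ M := by
  rintro T f ⟨hT, hf, hstate⟩
  obtain ⟨g, hg, hgM, hfg⟩ := exists_bounded_ae_eq_of_mem_controls hM.le hf
  have hgstate : S.state B z₀ g T = S.embed z₁ := by
    rw [← hstate, C0Semigroup.state, C0Semigroup.state, C0Semigroup.inputMap_congr T hfg]
  have hgbb : ∀ᵐ t ∂(volume.restrict (Set.Ioo (0 : ℝ) T)), ‖g t‖ = M := by
    by_contra hbb
    obtain ⟨t, ht, htT⟩ := hS.exists_mem_reachTimes_lt hB hd.le hk hobs hg hgM hgstate hbb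
    exact htT.not_ge (hT.1 ht)
  have hfgT : f =ᵐ[volume.restrict (Set.Ioo (0 : ℝ) T)] g :=
    ae_mono (Measure.restrict_mono Set.Ioo_subset_Ioi_self le_rfl) hfg
  filter_upwards [hgbb, hfgT] with t hgt hft
  rw [hft, hgt]
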